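/- **Theorem (intrinsic volumes of $\operatorname{span}\{v\}\oplus[0,\infty)^n$).** Let $v\in(\mathbb{R}\setminus\{0\})^n$ have at least one positive and at least one negative entry, and let $$P:=\operatorname{span}\{v\}\oplus[0,\infty)^n=\{\lambda v+u:\lambda\in\mathbb{R},\ u\in[0,\infty)^n\}\subset\mathbb{R}^n .$$ For a polyhedral cone $C\subset\mathbb{R}^n$ and $k\in\{0,\dots,n\}$, let $\nu_k(C):=\sum_{F}\mathbb{P}[\Pi_C(G)\in\operatorname{relint}F]$, where $F$ runs over the $k$-dimensional faces of $C$, $G\sim\mathcal{N}(0,I_n)$, and $\Pi_C$ is the Euclidean projection onto $C$. Let $$\Phi:\mathbb{C}\to\mathbb{C},\qquad \Phi(z):=\frac12+\frac1{\sqrt{2\pi}}\int_0^z e^{-t^2/2}\,dt ,$$ let $g\sim\mathcal{N}(0,1)$, $i:=\sqrt{-1}$, and $\|v\|_{LR}^2:=\sum_{j\in L\cup R}v_j^2$ for $L,R\subset[n]:=\{1,\dots,n\}$. Then for all $k\in\{1,\dots,n-1\}$, $$\nu_{n-k}(P)=\sum_{\substack{L\subset\{l\in[n]:\,v_l>0\},\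 R\subset\{r\in[n]:\,v_r<0\}\\ |L|+|R|=k+1}} \mathbb{E}\Bigl[\prod_{j\in L\cup R}\Phi\Bigl(\frac{i g v_j}{\|v\|_{LR}}\Bigr)\Bigr]\, \mathbb{E}\Bigl[\prod_{j\in[n]\setminus(L\cup R)}\Phi\Bigl(\frac{g v_j}{\|v\|_{LR}}\Bigr)\Bigr],$$ where all the random variables inside the expectations are integrable. Moreover, $$\nu_0(P)=0,\qquad \nu_n(P)=1-\sum_{k=0}^{n-1}\nu_k(P).$$ -/

import Mathlib

open MeasureTheory ProbabilityTheory
open scoped Pointwise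

noncomputable section

/-- `IsNearest C x y`: `y` is a point of `C` closest to `x` in the Euclidean norm. -/
def IsNearest {n : ℕ} (C : Set (EuclideanSpace ℝ (Fin n)))
    (x y : EuclideanSpace ℝ (Fin n)) : Prop :=
  y ∈ C ∧ ∀ z ∈ C, ‖x - y‖ ≤ ‖x - z‖

/-- The projection `Π_C x`: the closest point of `C` to `x`
(it exists and is unique for nonempty closed convex `C`, see `nearest_eq_iff`). -/
def nearest {n : ℕ} (C : Set (EuclideanSpace ℝ (Fin n)))
    (x : EuclideanSpace ℝ (Fin n)) : EuclideanSpace ℝ (Fin n) :=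
  Classical.epsilon (IsNearest C x)

/-- On a nonempty closed convex set the projection is the unique closest point. -/
theorem nearest_eq_iff {n : ℕ} {C : Set (EuclideanSpace ℝ (Fin n))} (hne : C.Nonempty)
    (hcl : IsClosed C) (hcv : Convex ℝ C) (x y : EuclideanSpace ℝ (Fin n)) :
    nearest C x = y ↔ IsNearest C x y := by
  have hex : ∃ y, IsNearest C x y := by
    obtain ⟨y, hy, h⟩ := hcl.exists_infDist_eq_dist hne x
    refine ⟨y, hy, fun z hz => ?_⟩
    rw [← dist_eq_norm, ← dist_eq_norm, ← h]
    exact Metric.infDist_le_dist_of_mem hz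
  have huniq : ∀ y z, IsNearest C x y → IsNearest C x z → y = z := by
    intro y z hy hz
    have hm : (1 / 2 : ℝ) • y + (1 / 2 : ℝ) • z ∈ C :=
      hcv hy.1 hz.1 (by norm_num) (by norm_num) (by norm_num)
    have h1 := hy.2 _ hm
    have h2 : ‖x - y‖ = ‖x - z‖ := le_antisymm (hy.2 _ hz.1) (hz.2 _ hy.1)
    have h3 := parallelogram_law_with_norm ℝ (x - y) (x - z)
    have h4 : x - y + (x - z) = (2 : ℝ) • (x - ((1 / 2 : ℝ) • y + (1 / 2 : ℝ) • z)) := by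
      module
    have h5 : x - y - (x - z) = z - y := by abel
    rw [h4, h5, norm_smul, Real.norm_of_nonneg (by norm_num : (0 : ℝ) ≤ 2), ← h2] at h3
    have h6 : ‖z - y‖ * ‖z - y‖ ≤ 0 := by
      nlinarith [norm_nonneg (x - y), mul_self_le_mul_self (norm_nonneg (x - y)) h1]
    have h7 : ‖z - y‖ = 0 := by nlinarith [norm_nonneg (z - y)]
    exact (sub_eq_zero.1 (norm_eq_zero.1 h7)).symm
  have hs : IsNearest C x (nearest C x) := Classical.epsilon_spec hex
  exact ⟨fun h => h ▸ hs, fun h => huniq _ _ hs h⟩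

/-- The `k`-dimensional faces of a polyhedron `C`: the nonempty sets of maximizers over `C` of a
linear functional (the functional `0` gives the face `C` itself) whose affine hull has
dimension `k`. -/
def polyFaces {n : ℕ} (C : Set (EuclideanSpace ℝ (Fin n))) (k : ℕ) :
    Set (Set (EuclideanSpace ℝ (Fin n))) :=
  {F | F.Nonempty ∧ IsExposed ℝ C F ∧ Module.finrank ℝ (affineSpan ℝ F).direction = k}

/-- `ν_F(C)`: the probability that the projection onto `C` of a standard Gaussian vector of `ℝⁿ`
lies in the relative interior of `F`. -/
def faceProb {n : ℕ} (C F : Set (EuclideanSpace ℝ (Fin n))) : ENNReal :=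
  stdGaussian (EuclideanSpace ℝ (Fin n)) {g | nearest C g ∈ intrinsicInterior ℝ F}

/-- The `k`-th intrinsic volume `ν_k(C)` of a polyhedral cone `C`: the sum of `ν_F(C)` over the
`k`-dimensional faces `F` of `C`. -/
def intrinsicVol {n : ℕ} (C : Set (EuclideanSpace ℝ (Fin n))) (k : ℕ) : ℝ :=
  (∑' F : polyFaces C k, faceProb C (F : Set (EuclideanSpace ℝ (Fin n)))).toReal

/-- The cone `span{v} ⊕ [0,∞)ⁿ` (Minkowski sum). -/
def spanOrthant {n : ℕ} (v : EuclideanSpace ℝ (Fin n)) : Set (EuclideanSpace ℝ (Fin n)) :=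
  (Submodule.span ℝ {v} : Set (EuclideanSpace ℝ (Fin n))) + {u | ∀ i, 0 ≤ u i}

/-- The complex Gaussian distribution function
`Φ(z) = 1/2 + (2π)^(-1/2) ∫_0^z exp(-t²/2) dt`, the path integral being taken along the segment
`t = s z`, `0 ≤ s ≤ 1` (the integrand is entire). -/
def cPhi (z : ℂ) : ℂ :=
  1 / 2 + 1 / (Real.sqrt (2 * Real.pi) : ℂ) *
    ∫ s in (0 : ℝ)..1, z * Complex.exp (-((s : ℂ) * z) ^ 2 / 2)

/-- `‖v‖_S = (∑_{j ∈ S} v_j²)^(1/2)`. -/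
def partNorm {n : ℕ} (v : EuclideanSpace ℝ (Fin n)) (S : Finset (Fin n)) : ℝ :=
  Real.sqrt (∑ j ∈ S, v j ^ 2)

/-- The pairs `(L, R)` with `L ⊆ {j : v_j > 0}`, `R ⊆ {j : v_j < 0}` and `|L| + |R| = m`. -/
def signPairs {n : ℕ} (v : EuclideanSpace ℝ (Fin n)) (m : ℕ) :
    Finset (Finset (Fin n) × Finset (Fin n)) :=
  {p | (∀ j ∈ p.1, 0 < v j) ∧ (∀ j ∈ p.2, v j < 0) ∧ p.1.card + p.2.card = m}

/-- The random variable `∏_{j ∈ S} Φ(i g v_j / ‖v‖_S)`, as a function of `g`. -/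
def innerProd {n : ℕ} (v : EuclideanSpace ℝ (Fin n)) (S : Finset (Fin n)) (g : ℝ) : ℂ :=
  ∏ j ∈ S, cPhi (Complex.I * g * v j / partNorm v S)

/-- The random variable `∏_{j ∉ S} Φ(g v_j / ‖v‖_S)`, as a function of `g`. -/
def outerProd {n : ℕ} (v : EuclideanSpace ℝ (Fin n)) (S : Finset (Fin n)) (g : ℝ) : ℂ :=
  ∏ j ∈ Sᶜ, cPhi (g * v j / partNorm v S)

end

/-!
The polar of the cone `P = span{v} + [0,∞)ⁿ` consists of the vectors `y ≤ 0` with `⟨y, v⟩ = 0`, so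
the faces of `P` are indexed by the possible supports `S` of such `y`: the empty set, which gives
`P` itself, and the sets on which `v` takes both signs, which give the faces
`{λ v + u : u ≥ 0, u_S = 0}` of dimension `n - |S| + 1` (`mem_polyFaces_iff`). By the optimality
conditions of the projection, `Π_P(g)` lies in the relative interior of the face of `S ≠ ∅` iff,
for `c = ⟨g_S, v_S⟩ / ‖v‖_S²`, one has `g_j ≤ c v_j` on `S` and `g_j > c v_j` off `S`
(`nearest_mem_coneFaceRel_iff`). These relative interiors partition `P`, whence the claims on `ν_0`
and `ν_n`.

Let `w = v_S / ‖v‖_S`, extended by zero. For a standard Gaussian vector `X`, the component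
`s = ⟨w, X⟩`, the residual `(X - s w)_S` and the coordinates of `X` off `S` are independent, so the
probability of the face is `ℙ[(X - s w)_S ≤ 0]` times `ℙ[X_j > s v_j / ‖v‖_S for all j ∉ S]`
(`stdGaussian_real_region`). Conditioning on `s` turns the second factor into the expectation of
`∏ Φ(s v_j / ‖v‖_S)`.

The first factor comes from Fourier inversion (`integral_prod_cPhi_I_mul`). Restricted to the event
`X_S ≤ 0`, the variable `s` has the density `φ(s) ℙ[(X - ⟨w, X⟩ w)_S + s w_S ≤ 0]`, which is
continuous at `0` and equals `(2π)^(-1/2) ℙ[(X - ⟨w, X⟩ w)_S ≤ 0]` there. Its Fourier transform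
factorizes over the coordinates, and since `∫_{t ≤ 0} φ(t) exp(-itx) dt = exp(-x²/2) Φ(ix)` it is
`exp(-a²/2) ∏_{j ∈ S} Φ(i a w_j)` at frequency `a`. As `|Φ(ix)| ≤ 7 exp(x²/2) / (1 + |x|)`
(`norm_cPhi_I_mul_le`), this is integrable for `|S| ≥ 2`, which also gives the integrability claim.

The formula sums over all sign patterns, including `S` on which `v` has constant sign. Such an `S`
contributes `0`: a residual with nonpositive coordinates that is orthogonal to `w` then vanishes.
-/

/-! ### Faces of the cone -/

/-- The set `{λ v + u : u ≥ 0, u_S = 0}`, written by coordinates. For `S = ∅` it is the whole cone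
`span{v} ⊕ [0,∞)ⁿ`; the proper faces are the ones for which `v` takes both signs on `S`. -/
def coneFace {n : ℕ} (v : EuclideanSpace ℝ (Fin n)) (S : Finset (Fin n)) :
    Set (EuclideanSpace ℝ (Fin n)) :=
  {x | ∃ c : ℝ, (∀ j ∈ S, x j = c * v j) ∧ ∀ j ∉ S, c * v j ≤ x j}

/-- The points `λ v + u` with `u_S = 0` and `u_j > 0` off `S`: the relative interior of
`coneFace v S`. -/
def coneFaceRel {n : ℕ} (v : EuclideanSpace ℝ (Fin n)) (S : Finset (Fin n)) :
    Set (EuclideanSpace ℝ (Fin n)) :=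
  {x | ∃ c : ℝ, (∀ j ∈ S, x j = c * v j) ∧ ∀ j ∉ S, c * v j < x j}

/-- The linear span of `coneFace v S`: the vectors proportional to `v` on `S`. -/
def coneFaceSpan {n : ℕ} (v : EuclideanSpace ℝ (Fin n)) (S : Finset (Fin n)) :
    Submodule ℝ (EuclideanSpace ℝ (Fin n)) where
  carrier := {x | ∃ c : ℝ, ∀ j ∈ S, x j = c * v j}
  zero_mem' := ⟨0, by simp⟩
  add_mem' := by
    rintro x y ⟨c, hc⟩ ⟨d, hd⟩
    exact ⟨c + d, fun j hj => by simp [hc j hj, hd j hj, add_mul]⟩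
  smul_mem' := by
    rintro a x ⟨c, hc⟩
    exact ⟨a * c, fun j hj => by simp [hc j hj, mul_assoc]⟩

/-- `v` takes both signs on `S`. -/
def IsMixed {n : ℕ} (v : EuclideanSpace ℝ (Fin n)) (S : Finset (Fin n)) : Prop :=
  (∃ j ∈ S, 0 < v j) ∧ ∃ j ∈ S, v j < 0

section Faces

variable {n : ℕ} {v : EuclideanSpace ℝ (Fin n)} {S T : Finset (Fin n)}

theorem mem_coneFaceSpan {x : EuclideanSpace ℝ (Fin n)} :
    x ∈ coneFaceSpan v S ↔ ∃ c : ℝ, ∀ j ∈ S, x j = c * v j := Iff.rfl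

theorem IsMixed.nonempty (h : IsMixed v S) : S.Nonempty := by
  obtain ⟨⟨j, hj, -⟩, -⟩ := h
  exact ⟨j, hj⟩

theorem IsMixed.two_le_card (h : IsMixed v S) : 2 ≤ S.card := by
  obtain ⟨⟨i, hi, hi'⟩, ⟨j, hj, hj'⟩⟩ := h
  refine Finset.one_lt_card.2 ⟨i, hi, j, hj, ?_⟩
  rintro rfl
  linarith

theorem spanOrthant_eq_coneFace (v : EuclideanSpace ℝ (Fin n)) :
    spanOrthant v = coneFace v ∅ := by
  ext x
  simp only [spanOrthant, coneFace, Set.mem_add, SetLike.mem_coe, Submodule.mem_span_singleton,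
    Set.mem_ofPred_eq]
  constructor
  · rintro ⟨_, ⟨c, rfl⟩, u, hu, rfl⟩
    exact ⟨c, by simp, fun j _ => by simpa using hu j⟩
  · rintro ⟨c, -, hc⟩
    exact ⟨c • v, ⟨c, rfl⟩, x - c • v, fun j => by simpa using hc j, by simp⟩

theorem zero_mem_coneFace : (0 : EuclideanSpace ℝ (Fin n)) ∈ coneFace v S := ⟨0, by simp, by simp⟩

theorem coneFaceRel_subset : coneFaceRel v S ⊆ coneFace v S :=
  fun _ ⟨c, h1, h2⟩ => ⟨c, h1, fun j hj => (h2 j hj).le⟩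

theorem coneFace_subset_coneFace_empty : coneFace v S ⊆ coneFace v ∅ := by
  rintro x ⟨c, h1, h2⟩
  refine ⟨c, by simp, fun j _ => ?_⟩
  by_cases hj : j ∈ S
  · exact (h1 j hj).ge
  · exact h2 j hj

theorem coneFaceRel_nonempty : (coneFaceRel v S).Nonempty :=
  ⟨WithLp.toLp 2 fun j => if j ∈ S then 0 else 1, 0, fun j hj => by simp [hj],
    fun j hj => by simp [hj]⟩

theorem affineSpan_coneFace :
    (affineSpan ℝ (coneFace v S) : Set (EuclideanSpace ℝ (Fin n))) = coneFaceSpan v S := by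
  rw [← Set.insert_eq_of_mem (zero_mem_coneFace (v := v) (S := S)), affineSpan_insert_zero]
  apply congrArg
  apply le_antisymm
  · rw [Submodule.span_le]
    rintro x ⟨c, h1, -⟩
    exact ⟨c, h1⟩
  · rintro x ⟨c, hc⟩
    -- split `x - c v` into its positive and negative parts, both of which vanish on `S`
    have h1 : (WithLp.toLp 2 fun j => c * v j + max (x j - c * v j) 0 :
        EuclideanSpace ℝ (Fin n)) ∈ coneFace v S :=
      ⟨c, fun j hj => by simp [hc j hj], fun j _ => by simp⟩
    have h2 : (WithLp.toLp 2 fun j => max (-(x j - c * v j)) 0 :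
        EuclideanSpace ℝ (Fin n)) ∈ coneFace v S :=
      ⟨0, fun j hj => by simp [hc j hj], fun j _ => by simp⟩
    have h3 := Submodule.sub_mem _ (Submodule.subset_span (R := ℝ) h1)
      (Submodule.subset_span (R := ℝ) h2)
    convert h3 using 1
    ext j
    simp only [PiLp.sub_apply]
    rcases le_total (x j - c * v j) 0 with h | h
    · rw [max_eq_right h, max_eq_left (by linarith)]; ring
    · rw [max_eq_left h, max_eq_right (by linarith)]; ring

theorem direction_affineSpan_coneFace :
    (affineSpan ℝ (coneFace v S)).direction = coneFaceSpan v S := by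
  apply SetLike.coe_injective
  have h0 : (0 : EuclideanSpace ℝ (Fin n)) ∈ affineSpan ℝ (coneFace v S) :=
    subset_affineSpan _ _ zero_mem_coneFace
  ext x
  rw [SetLike.mem_coe, AffineSubspace.mem_direction_iff_eq_vsub_right h0, ← affineSpan_coneFace]
  simp

/-- For a vector proportional to `v` on `S`, one coordinate in `S` determines the others, so
`|S| - 1` dimensions are lost; none when `S = ∅`, where the truncated subtraction gives `0`. -/
theorem finrank_coneFaceSpan (hv : ∀ i, v i ≠ 0) :
    Module.finrank ℝ (coneFaceSpan v S) = n - (S.card - 1) := by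
  rcases S.eq_empty_or_nonempty with rfl | ⟨i, hi⟩
  · have : coneFaceSpan v ∅ = ⊤ := by
      ext x; simp [mem_coneFaceSpan]
    rw [this]; simp
  · let f : EuclideanSpace ℝ (Fin n) →ₗ[ℝ] ({j // j ∈ S.erase i} → ℝ) :=
      { toFun := fun x j => x j - x i / v i * v j
        map_add' := fun x y => by ext j; simp; ring
        map_smul' := fun a x => by ext j; simp; ring }
    have hf (x : EuclideanSpace ℝ (Fin n)) (j : {j // j ∈ S.erase i}) :
      f x j = x j - x i / v i * v j := rfl
    have hker : LinearMap.ker f = coneFaceSpan v S := by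
      ext x
      rw [LinearMap.mem_ker, mem_coneFaceSpan]
      constructor
      · intro h
        refine ⟨x i / v i, fun j hj => ?_⟩
        by_cases hji : j = i
        · subst hji; field_simp [hv j]
        · have := congrFun h ⟨j, Finset.mem_erase.2 ⟨hji, hj⟩⟩
          rw [hf] at this
          simp only [Pi.zero_apply] at this
          linarith
      · rintro ⟨c, hc⟩
        ext j
        rw [hf, hc _ (Finset.mem_of_mem_erase j.2), hc i hi]
        have := hv i
        simp only [Pi.zero_apply]
        field_simp
        ring
    have hsurj : LinearMap.range f = ⊤ := by
      rw [LinearMap.range_eq_top]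
      intro y
      refine ⟨WithLp.toLp 2 fun j => if h : j ∈ S.erase i then y ⟨j, h⟩ else 0, ?_⟩
      ext j
      rw [hf]
      have hj := j.2
      simp only [Finset.notMem_erase, hj, dite_true]
      simp
    have := LinearMap.finrank_range_add_finrank_ker f
    rw [hsurj, hker, finrank_top, Module.finrank_fintype_fun_eq_card] at this
    simp only [Fintype.card_coe, Finset.card_erase_of_mem hi, finrank_euclideanSpace,
      Fintype.card_fin] at this
    omega

theorem intrinsicInterior_coneFace (hv : ∀ i, v i ≠ 0) :
    intrinsicInterior ℝ (coneFace v S) = coneFaceRel v S := by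
  have hspan (y : EuclideanSpace ℝ (Fin n)) :
      y ∈ affineSpan ℝ (coneFace v S) ↔ y ∈ coneFaceSpan v S := by
    rw [← SetLike.mem_coe, affineSpan_coneFace, SetLike.mem_coe]
  ext x
  rw [mem_intrinsicInterior]
  constructor
  · rintro ⟨y, hy, rfl⟩
    obtain ⟨ε, hε, hball⟩ := Metric.mem_nhds_iff.1 (mem_interior_iff_mem_nhds.1 hy)
    -- the vector `u` below is positive off `S` and vanishes on `S`
    set u : EuclideanSpace ℝ (Fin n) := WithLp.toLp 2 fun j => if j ∈ S then 0 else 1 with hu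
    have hpos : 0 < ε / (2 * (‖u‖ + 1)) := by positivity
    set δ := ε / (2 * (‖u‖ + 1)) with hδ
    obtain ⟨c, hc⟩ := (hspan _).1 y.2
    have hz : (y : EuclideanSpace ℝ (Fin n)) - δ • u ∈ affineSpan ℝ (coneFace v S) :=
      (hspan _).2 ⟨c, fun j hj => by simp [hc j hj, hu, hj]⟩
    have hz' := @hball ⟨_, hz⟩ (by
      rw [Metric.mem_ball, Subtype.dist_eq, dist_eq_norm]
      simp only [sub_sub_cancel_left, norm_neg, norm_smul]
      rw [Real.norm_of_nonneg hpos.le, hδ, div_mul_eq_mul_div, div_lt_iff₀ (by positivity)]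
      nlinarith [norm_nonneg u])
    obtain ⟨d, h1, h2⟩ := hz'
    refine ⟨d, fun j hj => ?_, fun j hj => ?_⟩
    · have := h1 j hj
      simpa [hu, hj] using this
    · have := h2 j hj
      simp only [PiLp.sub_apply, PiLp.smul_apply, hu, hj, if_false, smul_eq_mul, mul_one] at this
      linarith
  · rintro ⟨c, h1, h2⟩
    -- the coefficient of `v` can be chosen continuously on the span
    obtain ⟨m, hm, hmx, hmS⟩ : ∃ m : EuclideanSpace ℝ (Fin n) → ℝ, Continuous m ∧ m x = c ∧
        ∀ y ∈ coneFaceSpan v S, ∀ j ∈ S, y j = m y * v j := by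
      rcases S.eq_empty_or_nonempty with rfl | ⟨i, hi⟩
      · exact ⟨fun _ => c, continuous_const, rfl, by simp⟩
      · refine ⟨fun y => y i / v i, by fun_prop, ?_, ?_⟩
        · have := hv i
          simp only [h1 i hi]; field_simp
        · rintro y ⟨d, hd⟩ j hj
          have := hv i
          simp only [hd i hi, hd j hj]; field_simp
    refine ⟨⟨x, (hspan x).2 ⟨c, h1⟩⟩, ?_, rfl⟩
    rw [mem_interior]
    refine ⟨{y | ∀ j ∈ Sᶜ, m y * v j < (y : EuclideanSpace ℝ (Fin n)) j}, ?_, ?_, ?_⟩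
    · intro y hy
      exact ⟨m y, hmS y ((hspan _).1 y.2), fun j hj => (hy j (Finset.mem_compl.2 hj)).le⟩
    · have : {y : affineSpan ℝ (coneFace v S) | ∀ j ∈ Sᶜ, m y * v j <
          (y : EuclideanSpace ℝ (Fin n)) j} = ⋂ j ∈ Sᶜ, {y : affineSpan ℝ (coneFace v S) |
            m y * v j < (y : EuclideanSpace ℝ (Fin n)) j} := by ext; simp
      rw [this]
      refine isOpen_biInter_finset fun j _ => isOpen_lt ?_ ?_
      · exact (hm.comp continuous_subtype_val).mul continuous_const
      · fun_prop
    · intro j hj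
      simp only [hmx]
      exact h2 j (Finset.mem_compl.1 hj)

/-- The exposed faces of the cone are the sets `coneFace v S` with `S = ∅` or `v` of both signs on
`S`: a functional is bounded above on the cone iff its coefficients are nonpositive and orthogonal
to `v`, and `S` is then its support. -/
theorem mem_polyFaces_iff (hv : ∀ i, v i ≠ 0) {F : Set (EuclideanSpace ℝ (Fin n))} {k : ℕ} :
    F ∈ polyFaces (spanOrthant v) k ↔
      ∃ S : Finset (Fin n), (S = ∅ ∨ IsMixed v S) ∧ n - (S.card - 1) = k ∧ coneFace v S = F := by
  rw [spanOrthant_eq_coneFace]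
  constructor
  · rintro ⟨hne, hex, hdim⟩
    obtain ⟨l, hl⟩ := hex hne
    obtain ⟨x, hx⟩ := hne
    rw [hl] at hx
    obtain ⟨⟨c, -, hc⟩, hmax⟩ := hx
    have hc' (j) : c * v j ≤ x j := hc j (by simp)
    let y : Fin n → ℝ := fun j => l (EuclideanSpace.single j 1)
    have hly (z : EuclideanSpace ℝ (Fin n)) : l z = ∑ j, z j * y j := by
      conv_lhs => rw [← (EuclideanSpace.basisFun (Fin n) ℝ).sum_repr z]
      simp [y]
    have hlx : l x = 0 := by
      apply le_antisymm
      · have := hmax ((2 : ℝ) • x) ⟨2 * c, by simp, fun j _ => by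
          have := hc' j
          simp only [PiLp.smul_apply, smul_eq_mul]; linarith⟩
        rw [map_smul, smul_eq_mul] at this
        linarith
      · simpa using hmax 0 zero_mem_coneFace
    have hlv : l v = 0 := by
      apply le_antisymm
      · exact (hmax v ⟨1, by simp, by simp⟩).trans hlx.le
      · have := hmax (-v) ⟨-1, by simp, by simp⟩
        rw [map_neg, hlx] at this
        linarith
    have hy (j) : y j ≤ 0 := by
      refine (hmax _ ⟨0, by simp, fun i _ => ?_⟩).trans hlx.le
      by_cases h : i = j <;> simp [h]
    let S : Finset (Fin n) := {j | y j < 0}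
    have hmemS (j) : j ∈ S ↔ y j < 0 := by simp [S]
    have hyS (j) (hj : j ∉ S) : y j = 0 := le_antisymm (hy j) (not_lt.1 ((hmemS j).not.1 hj))
    have hsumv : ∑ j ∈ S, v j * y j = 0 := by
      rw [hly, ← Finset.sum_subset (Finset.subset_univ S)] at hlv
      · exact hlv
      · intro j _ hj; simp [hyS j hj]
    have hFS : F = coneFace v S := by
      rw [hl]
      ext z
      constructor
      · rintro ⟨⟨d, -, hd⟩, hz⟩
        have hz0 : l z = 0 := le_antisymm ((hmax z ⟨d, by simp, hd⟩).trans hlx.le)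
          (by simpa using hz 0 zero_mem_coneFace)
        have h0 : ∑ j, (z j - d * v j) * y j = 0 := by
          rw [hly] at hz0 hlv
          simp only [sub_mul, Finset.sum_sub_distrib, hz0, mul_assoc, ← Finset.mul_sum, hlv]
          simp
        have h1 := (Finset.sum_eq_zero_iff_of_nonpos fun j _ =>
          mul_nonpos_of_nonneg_of_nonpos (sub_nonneg.2 (hd j (by simp))) (hy j)).1 h0
        refine ⟨d, fun j hj => ?_, fun j _ => hd j (by simp)⟩
        rcases mul_eq_zero.1 (h1 j (Finset.mem_univ j)) with h | h
        · linarith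
        · exact absurd h ((hmemS j).1 hj).ne
      · rintro ⟨d, h1, h2⟩
        refine ⟨coneFace_subset_coneFace_empty ⟨d, h1, h2⟩, fun w hw => (hmax w hw).trans ?_⟩
        have : l (z - d • v) = 0 := by
          rw [hly]
          refine Finset.sum_eq_zero fun j _ => ?_
          by_cases hj : j ∈ S
          · simp [h1 j hj]
          · simp [hyS j hj]
        rw [map_sub, map_smul, hlv, smul_zero, sub_zero] at this
        rw [hlx, this]
    refine ⟨S, ?_, ?_, hFS.symm⟩
    · rcases S.eq_empty_or_nonempty with h | h
      · exact Or.inl h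
      · refine Or.inr ⟨?_, ?_⟩
        · by_contra! hcon
          have : 0 < ∑ j ∈ S, v j * y j := Finset.sum_pos (fun j hj =>
            mul_pos_of_neg_of_neg (lt_of_le_of_ne (hcon j hj) (hv j)) ((hmemS j).1 hj)) h
          linarith
        · by_contra! hcon
          have : ∑ j ∈ S, v j * y j < 0 := Finset.sum_neg (fun j hj =>
            mul_neg_of_pos_of_neg (lt_of_le_of_ne (hcon j hj) (hv j).symm) ((hmemS j).1 hj)) h
          linarith
    · rw [← hdim, hFS, direction_affineSpan_coneFace, finrank_coneFaceSpan hv]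
  · rintro ⟨S, hS, hk, rfl⟩
    refine ⟨⟨0, zero_mem_coneFace⟩, fun _ => ?_, ?_⟩
    · -- a functional with support `S`, negative on `S` and orthogonal to `v`
      obtain ⟨y, hyS, hyn, hyv⟩ : ∃ y : Fin n → ℝ, (∀ j ∈ S, y j < 0) ∧ (∀ j ∉ S, y j = 0) ∧
          ∑ j, v j * y j = 0 := by
        rcases hS with rfl | ⟨⟨p, hpS, hp⟩, q, hqS, hq⟩
        · exact ⟨0, by simp⟩
        · set A := ∑ j ∈ S, max (v j) 0 with hA
          set B := ∑ j ∈ S, max (-v j) 0 with hB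
          have hA0 : 0 < A := Finset.sum_pos' (fun j _ => le_max_right _ _)
            ⟨p, hpS, lt_max_of_lt_left hp⟩
          have hB0 : 0 < B := Finset.sum_pos' (fun j _ => le_max_right _ _)
            ⟨q, hqS, lt_max_of_lt_left (by linarith)⟩
          refine ⟨fun j => if j ∈ S then (if 0 < v j then -B else -A) else 0, ?_, ?_, ?_⟩
          · intro j hj
            simp only [hj, if_true]
            split_ifs <;> linarith
          · intro j hj; simp [hj]
          · have h1 (j) : v j * (if j ∈ S then (if 0 < v j then -B else -A) else 0) =
                if j ∈ S then max (-v j) 0 * A - max (v j) 0 * B else 0 := by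
              split_ifs with h1 h2
              · rw [max_eq_right (by linarith), max_eq_left h2.le]; ring
              · rw [max_eq_left (by linarith), max_eq_right (by linarith)]; ring
              · simp
            simp only [h1, Finset.sum_ite_mem, Finset.univ_inter, Finset.sum_sub_distrib,
              ← Finset.sum_mul]
            rw [← hA, ← hB]; ring
      let l : StrongDual ℝ (EuclideanSpace ℝ (Fin n)) :=
        ∑ j, y j • EuclideanSpace.proj (𝕜 := ℝ) j
      have hl (z) : l z = ∑ j, z j * y j := by
        simp [l, mul_comm]
      have hval (z : EuclideanSpace ℝ (Fin n)) (d : ℝ) : l z = ∑ j, (z j - d * v j) * y j := by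
        simp only [hl, sub_mul, Finset.sum_sub_distrib, mul_assoc, ← Finset.mul_sum, hyv]
        simp
      have hy (j) : y j ≤ 0 := by
        by_cases hj : j ∈ S
        · exact (hyS j hj).le
        · exact (hyn j hj).le
      have hle (z) (hz : z ∈ coneFace v ∅) : l z ≤ 0 := by
        obtain ⟨d, -, hd⟩ := hz
        rw [hval z d]
        exact Finset.sum_nonpos fun j _ =>
          mul_nonpos_of_nonneg_of_nonpos (sub_nonneg.2 (hd j (by simp))) (hy j)
      refine ⟨l, ?_⟩
      ext z
      constructor
      · rintro ⟨d, h1, h2⟩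
        refine ⟨coneFace_subset_coneFace_empty ⟨d, h1, h2⟩, fun w hw => (hle w hw).trans ?_⟩
        rw [hval z d]
        refine (Finset.sum_eq_zero fun j _ => ?_).ge
        by_cases hj : j ∈ S
        · simp [h1 j hj]
        · simp [hyn j hj]
      · rintro ⟨⟨d, -, hd⟩, hz⟩
        have hz0 : l z = 0 := le_antisymm (hle z ⟨d, by simp, hd⟩)
          (by simpa using hz 0 zero_mem_coneFace)
        rw [hval z d] at hz0
        have h1 := (Finset.sum_eq_zero_iff_of_nonpos fun j _ =>
          mul_nonpos_of_nonneg_of_nonpos (sub_nonneg.2 (hd j (by simp))) (hy j)).1 hz0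
        refine ⟨d, fun j hj => ?_, fun j _ => hd j (by simp)⟩
        rcases mul_eq_zero.1 (h1 j (Finset.mem_univ j)) with h | h
        · linarith
        · exact absurd h (hyS j hj).ne
    · rw [direction_affineSpan_coneFace, finrank_coneFaceSpan hv, hk]

/-- The relative interiors of distinct faces are disjoint: if the coefficients of `v` in two
representations of a point differ, then `v` has a constant sign on each of the index sets. -/
theorem eq_of_mem_coneFaceRel (hS : S = ∅ ∨ IsMixed v S) (hT : T = ∅ ∨ IsMixed v T)
    {x : EuclideanSpace ℝ (Fin n)} (hxS : x ∈ coneFaceRel v S) (hxT : x ∈ coneFaceRel v T) :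
    S = T := by
  obtain ⟨c, h1, h2⟩ := hxS
  obtain ⟨d, h3, h4⟩ := hxT
  have hc (j) : c * v j ≤ x j := by
    by_cases hj : j ∈ S
    exacts [(h1 j hj).ge, (h2 j hj).le]
  have hd (j) : d * v j ≤ x j := by
    by_cases hj : j ∈ T
    exacts [(h3 j hj).ge, (h4 j hj).le]
  have keyS (hne : c ≠ d) : S = ∅ := by
    refine hS.resolve_right ?_
    rintro ⟨⟨p, hpS, hp⟩, q, hqS, hq⟩
    have := hd p; have := h1 p hpS; have := hd q; have := h1 q hqS
    rcases lt_or_gt_of_ne hne with h | h <;> nlinarith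
  have keyT (hne : c ≠ d) : T = ∅ := by
    refine hT.resolve_right ?_
    rintro ⟨⟨p, hpT, hp⟩, q, hqT, hq⟩
    have := hc p; have := h3 p hpT; have := hc q; have := h3 q hqT
    rcases lt_or_gt_of_ne hne with h | h <;> nlinarith
  by_cases hcd : c = d
  · subst hcd
    ext j
    constructor
    · intro hj; by_contra hj'
      exact (h4 j hj').ne' (h1 j hj)
    · intro hj; by_contra hj'
      exact (h2 j hj').ne' (h3 j hj)
  · rw [keyS hcd, keyT hcd]

theorem coneFace_injOn (hv : ∀ i, v i ≠ 0) :
    Set.InjOn (coneFace v) {S | S = ∅ ∨ IsMixed v S} := by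
  intro S hS T hT h
  obtain ⟨x, hx⟩ := coneFaceRel_nonempty (v := v) (S := S)
  refine eq_of_mem_coneFaceRel hS hT hx ?_
  rwa [← intrinsicInterior_coneFace hv, ← h, intrinsicInterior_coneFace hv]

/-- The indices giving the largest and the smallest admissible coefficient of `v` in a
representation of `x` as a point of the cone. -/
theorem exists_extremal_ratios (hpos : ∃ i, 0 < v i) (hneg : ∃ i, v i < 0)
    (x : EuclideanSpace ℝ (Fin n)) :
    ∃ p q, 0 < v p ∧ v q < 0 ∧ (∀ i, 0 < v i → x p / v p ≤ x i / v i) ∧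
      ∀ i, v i < 0 → x i / v i ≤ x q / v q := by
  obtain ⟨i, hi⟩ := hpos
  obtain ⟨j, hj⟩ := hneg
  obtain ⟨p, hp, hp'⟩ := Finset.exists_min_image (Finset.univ.filter fun i => 0 < v i)
    (fun i => x i / v i) ⟨i, by simpa using hi⟩
  obtain ⟨q, hq, hq'⟩ := Finset.exists_max_image (Finset.univ.filter fun i => v i < 0)
    (fun i => x i / v i) ⟨j, by simpa using hj⟩
  simp only [Finset.mem_filter, Finset.mem_univ, true_and] at hp hp' hq hq'
  exact ⟨p, q, hp, hq, hp', hq'⟩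

theorem mem_coneFace_empty_iff (hv : ∀ i, v i ≠ 0) (hpos : ∃ i, 0 < v i) (hneg : ∃ i, v i < 0)
    {x : EuclideanSpace ℝ (Fin n)} :
    x ∈ coneFace v ∅ ↔ ∀ p q, 0 < v p → v q < 0 → x q / v q ≤ x p / v p := by
  constructor
  · rintro ⟨c, -, hc⟩ p q hp hq
    exact ((div_le_iff_of_neg hq).2 (hc q (by simp))).trans
      ((le_div_iff₀ hp).2 (hc p (by simp)))
  · intro h
    obtain ⟨p, q, hp, hq, hp', hq'⟩ := exists_extremal_ratios hpos hneg x
    refine ⟨x p / v p, by simp, fun j _ => ?_⟩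
    rcases lt_or_gt_of_ne (hv j) with hj | hj
    · exact (div_le_iff_of_neg hj).1 (h p j hp hj)
    · exact (le_div_iff₀ hj).1 (hp' j hj)

theorem isClosed_spanOrthant (hv : ∀ i, v i ≠ 0) (hpos : ∃ i, 0 < v i) (hneg : ∃ i, v i < 0) :
    IsClosed (spanOrthant v) := by
  rw [spanOrthant_eq_coneFace]
  have : coneFace v ∅ = {x | ∀ p q, 0 < v p → v q < 0 → x q / v q ≤ x p / v p} := by
    ext x; exact mem_coneFace_empty_iff hv hpos hneg
  rw [this]
  simp only [Set.ofPred_forall]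
  refine isClosed_iInter fun p => isClosed_iInter fun q => isClosed_iInter fun _ =>
    isClosed_iInter fun _ => isClosed_le (by fun_prop) (by fun_prop)

theorem convex_spanOrthant : Convex ℝ (spanOrthant v) := by
  rw [spanOrthant_eq_coneFace]
  rintro x ⟨c, -, hc⟩ y ⟨d, -, hd⟩ a b ha hb -
  refine ⟨a * c + b * d, by simp, fun j hj => ?_⟩
  have h1 := mul_le_mul_of_nonneg_left (hc j hj) ha
  have h2 := mul_le_mul_of_nonneg_left (hd j hj) hb
  simp only [PiLp.add_apply, PiLp.smul_apply, smul_eq_mul]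
  linarith

theorem exists_mem_coneFaceRel (hv : ∀ i, v i ≠ 0) (hpos : ∃ i, 0 < v i) (hneg : ∃ i, v i < 0)
    {x : EuclideanSpace ℝ (Fin n)} (hx : x ∈ spanOrthant v) :
    ∃ S, (S = ∅ ∨ IsMixed v S) ∧ x ∈ coneFaceRel v S := by
  rw [spanOrthant_eq_coneFace, mem_coneFace_empty_iff hv hpos hneg] at hx
  obtain ⟨p, q, hp, hq, hp', hq'⟩ := exists_extremal_ratios hpos hneg x
  rcases (hx p q hp hq).lt_or_eq with h | h
  · -- the admissible coefficients form a nondegenerate interval: take an inner point of it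
    obtain ⟨c, hc1, hc2⟩ := exists_between h
    refine ⟨∅, Or.inl rfl, c, by simp, fun j _ => ?_⟩
    rcases lt_or_gt_of_ne (hv j) with hj | hj
    · exact (div_lt_iff_of_neg hj).1 ((hq' j hj).trans_lt hc1)
    · exact (lt_div_iff₀ hj).1 (hc2.trans_le (hp' j hj))
  · -- there is a single admissible coefficient, attained at indices of both signs
    refine ⟨Finset.univ.filter fun j => x j = x p / v p * v j,
      Or.inr ⟨⟨p, by simp [hv p], hp⟩, q, by simp [← h, hv q], hq⟩, x p / v p, by simp,
      fun j hj => lt_of_le_of_ne ?_ ?_⟩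
    · rcases lt_or_gt_of_ne (hv j) with hj | hj
      · exact (div_le_iff_of_neg hj).1 (hx p j hp hj)
      · exact (le_div_iff₀ hj).1 (hp' j hj)
    · intro h'; simp [h'] at hj

/-! ### The projection onto the cone -/

/-- The coefficient `⟨x_S, v_S⟩ / ‖v_S‖²` of the orthogonal projection of `x_S` onto the line
spanned by `v_S`. -/
noncomputable def lineCoeff (v : EuclideanSpace ℝ (Fin n)) (S : Finset (Fin n))
    (x : EuclideanSpace ℝ (Fin n)) : ℝ :=
  (∑ j ∈ S, x j * v j) / ∑ j ∈ S, v j ^ 2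

/-- The set of points whose projection onto the cone lies in the relative interior of
`coneFace v S`, for `v` of both signs on `S`. -/
def projRegion (v : EuclideanSpace ℝ (Fin n)) (S : Finset (Fin n)) :
    Set (EuclideanSpace ℝ (Fin n)) :=
  {x | (∀ j ∈ S, x j ≤ lineCoeff v S x * v j) ∧ ∀ j ∉ S, lineCoeff v S x * v j < x j}

theorem continuous_lineCoeff : Continuous (lineCoeff v S) := by
  unfold lineCoeff
  fun_prop

theorem measurableSet_projRegion : MeasurableSet (projRegion v S) := by
  have : projRegion v S = (⋂ j ∈ S, {x | x j ≤ lineCoeff v S x * v j}) ∩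
      ⋂ j ∈ Sᶜ, {x | lineCoeff v S x * v j < x j} := by
    ext x; simp [projRegion]
  rw [this]
  have := continuous_lineCoeff (v := v) (S := S)
  refine (Finset.measurableSet_biInter _ fun j _ => ?_).inter
    (Finset.measurableSet_biInter _ fun j _ => ?_)
  · exact (isClosed_le (by fun_prop) (by fun_prop)).measurableSet
  · exact (isOpen_lt (by fun_prop) (by fun_prop)).measurableSet

theorem isNearest_iff_inner_nonpos {C : Set (EuclideanSpace ℝ (Fin n))} (hC : Convex ℝ C)
    {g x : EuclideanSpace ℝ (Fin n)} :
    IsNearest C g x ↔ x ∈ C ∧ ∀ z ∈ C, inner ℝ (g - x) (z - x) ≤ 0 := by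
  refine and_congr_right fun hx => ?_
  rw [← norm_eq_iInf_iff_real_inner_le_zero hC hx]
  have : Nonempty C := ⟨⟨x, hx⟩⟩
  have hbdd : BddBelow (Set.range fun w : C => ‖g - w‖) := ⟨0, by rintro _ ⟨w, rfl⟩; positivity⟩
  constructor
  · intro h
    exact le_antisymm (le_ciInf fun z => h z z.2) (ciInf_le hbdd ⟨x, hx⟩)
  · intro h z hz
    rw [h]
    exact ciInf_le hbdd ⟨z, hz⟩

theorem sum_sq_pos (hv : ∀ i, v i ≠ 0) (hS : S.Nonempty) : 0 < ∑ j ∈ S, v j ^ 2 :=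
  Finset.sum_pos (fun j _ => by have := hv j; positivity) hS

/-- The optimality conditions of the projection: the residual `g - Π g` is nonpositive,
orthogonal to `v`, and vanishes off `S`. -/
theorem nearest_mem_coneFaceRel_iff (hv : ∀ i, v i ≠ 0) (hpos : ∃ i, 0 < v i)
    (hneg : ∃ i, v i < 0) (hS : S.Nonempty) (g : EuclideanSpace ℝ (Fin n)) :
    nearest (spanOrthant v) g ∈ coneFaceRel v S ↔ g ∈ projRegion v S := by
  have hne : (spanOrthant v).Nonempty := by
    rw [spanOrthant_eq_coneFace]; exact ⟨0, zero_mem_coneFace⟩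
  have hnear := nearest_eq_iff hne (isClosed_spanOrthant hv hpos hneg) convex_spanOrthant g
  simp only [isNearest_iff_inner_nonpos (convex_spanOrthant (v := v))] at hnear
  have hV := sum_sq_pos hv hS
  have hinner (x y : EuclideanSpace ℝ (Fin n)) : inner ℝ x y = ∑ j, x j * y j := by
    simp [PiLp.inner_apply, mul_comm]
  constructor
  · rintro ⟨c, h1, h2⟩
    obtain ⟨hx, hopt⟩ := (hnear _).1 rfl
    set x := nearest (spanOrthant v) g
    rw [spanOrthant_eq_coneFace] at hopt
    have hc (j) : c * v j ≤ x j := by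
      by_cases hj : j ∈ S
      exacts [(h1 j hj).ge, (h2 j hj).le]
    have hy (j) : g j ≤ x j := by
      have := hopt (x + EuclideanSpace.single j 1) ⟨c, by simp, fun i _ => by
        have := hc i
        by_cases h : i = j
        · subst h; simp; linarith
        · simpa [h] using this⟩
      simpa [hinner] using this
    have hyoff (j) (hj : j ∉ S) : g j = x j := by
      refine le_antisymm (hy j) ?_
      have hlt := h2 j hj
      have := hopt (x + EuclideanSpace.single j (c * v j - x j)) ⟨c, by simp, fun i _ => by
        have := hc i
        by_cases h : i = j
        · subst h; simp
        · simpa [h] using this⟩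
      simp only [add_sub_cancel_left, hinner, PiLp.sub_apply, PiLp.single_apply, mul_ite, mul_zero,
        Finset.sum_ite_eq', Finset.mem_univ, if_true] at this
      nlinarith
    have hyv : ∑ j, (g j - x j) * v j = 0 := by
      have e1 := hopt (x + v) ⟨c + 1, by simp, fun i _ => by
        have := hc i; simp only [PiLp.add_apply]; linarith⟩
      have e2 := hopt (x - v) ⟨c - 1, by simp, fun i _ => by
        have := hc i; simp only [PiLp.sub_apply]; linarith⟩
      rw [add_sub_cancel_left, hinner] at e1
      rw [sub_sub_cancel_left, inner_neg_right, hinner] at e2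
      simp only [PiLp.sub_apply] at e1 e2
      linarith
    have hyv' : ∑ j ∈ S, (g j - x j) * v j = 0 := by
      rw [← hyv]
      exact Finset.sum_subset (Finset.subset_univ _) fun j _ hj => by rw [hyoff j hj]; ring
    have hcg : lineCoeff v S g = c := by
      rw [lineCoeff, div_eq_iff hV.ne', Finset.mul_sum, ← sub_eq_zero, ← Finset.sum_sub_distrib,
        ← hyv']
      exact Finset.sum_congr rfl fun j hj => by rw [h1 j hj]; ring
    refine ⟨fun j hj => ?_, fun j hj => ?_⟩
    · rw [hcg, ← h1 j hj]; exact hy j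
    · rw [hcg, hyoff j hj]; exact h2 j hj
  · rintro ⟨h1, h2⟩
    set c := lineCoeff v S g with hcdef
    have hcV : ∑ j ∈ S, (g j - c * v j) * v j = 0 := by
      simp only [sub_mul, Finset.sum_sub_distrib, mul_assoc, ← Finset.mul_sum, ← sq]
      rw [hcdef, lineCoeff, div_mul_cancel₀ _ hV.ne', sub_self]
    set x : EuclideanSpace ℝ (Fin n) := WithLp.toLp 2 fun j => if j ∈ S then c * v j else g j
      with hx
    have hxS (j) (hj : j ∈ S) : x j = c * v j := by simp [hx, hj]
    have hxn (j) (hj : j ∉ S) : x j = g j := by simp [hx, hj]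
    have hxrel : x ∈ coneFaceRel v S := ⟨c, hxS, fun j hj => by rw [hxn j hj]; exact h2 j hj⟩
    rw [(hnear x).2 ⟨?_, ?_⟩]
    · exact hxrel
    · rw [spanOrthant_eq_coneFace]
      exact coneFace_subset_coneFace_empty (coneFaceRel_subset hxrel)
    · rw [spanOrthant_eq_coneFace]
      rintro z ⟨d, -, hd⟩
      have hsum : inner ℝ (g - x) (z - x) = ∑ j ∈ S, (g j - c * v j) * (z j - d * v j) := by
        have : ∑ j ∈ S, (g j - c * v j) * (z j - d * v j) =
            ∑ j ∈ S, (g j - x j) * (z j - x j) - (d - c) * ∑ j ∈ S, (g j - c * v j) * v j := by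
          rw [Finset.mul_sum, ← Finset.sum_sub_distrib]
          exact Finset.sum_congr rfl fun j hj => by rw [hxS j hj]; ring
        rw [this, hcV, mul_zero, sub_zero, hinner]
        exact (Finset.sum_subset (Finset.subset_univ _) fun j _ hj => by simp [hxn j hj]).symm
      rw [hsum]
      exact Finset.sum_nonpos fun j hj => mul_nonpos_of_nonpos_of_nonneg
        (sub_nonpos.2 (h1 j hj)) (sub_nonneg.2 (hd j (by simp)))

end Faces

/-! ### Intrinsic volumes as sums over index sets -/

section Volumes

variable {n : ℕ} {v : EuclideanSpace ℝ (Fin n)} {S T : Finset (Fin n)}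

theorem two_le_of_signs (hpos : ∃ i, 0 < v i) (hneg : ∃ i, v i < 0) : 2 ≤ n := by
  have : IsMixed v Finset.univ :=
    ⟨hpos.imp fun _ h => ⟨Finset.mem_univ _, h⟩, hneg.imp fun _ h => ⟨Finset.mem_univ _, h⟩⟩
  simpa using this.two_le_card

open Classical in
theorem intrinsicVol_eq_sum (hv : ∀ i, v i ≠ 0) (k : ℕ) :
    intrinsicVol (spanOrthant v) k =
      ∑ S : Finset (Fin n) with (S = ∅ ∨ IsMixed v S) ∧ n - (S.card - 1) = k,
        (stdGaussian (EuclideanSpace ℝ (Fin n))).real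
          {g | nearest (spanOrthant v) g ∈ coneFaceRel v S} := by
  set A : Finset (Finset (Fin n)) := {S | (S = ∅ ∨ IsMixed v S) ∧ n - (S.card - 1) = k} with hA
  have hfaces : polyFaces (spanOrthant v) k = coneFace v '' (A : Set (Finset (Fin n))) := by
    ext F
    rw [mem_polyFaces_iff hv]
    simp [hA, and_assoc]
  have hinj : Set.InjOn (coneFace v) (A : Set (Finset (Fin n))) :=
    (coneFace_injOn hv).mono fun S hS => by
      have : S ∈ A := hS
      simp only [hA, Finset.mem_filter] at this
      exact this.2.1
  rw [intrinsicVol, hfaces, tsum_image (faceProb (spanOrthant v)) hinj,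
    Finset.tsum_subtype' A fun S => faceProb (spanOrthant v) (coneFace v S),
    ENNReal.toReal_sum (f := fun S => faceProb (spanOrthant v) (coneFace v S))
      fun S _ => measure_ne_top _ _]
  refine Finset.sum_congr rfl fun S _ => ?_
  rw [faceProb, intrinsicInterior_coneFace hv, measureReal_def]

theorem intrinsicVol_zero (hv : ∀ i, v i ≠ 0) (hpos : ∃ i, 0 < v i) (hneg : ∃ i, v i < 0) :
    intrinsicVol (spanOrthant v) 0 = 0 := by
  classical
  rw [intrinsicVol_eq_sum hv, Finset.filter_false_of_mem, Finset.sum_empty]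
  rintro S - ⟨-, h⟩
  have h1 := two_le_of_signs hpos hneg
  have h2 := S.card_le_univ
  rw [Fintype.card_fin] at h2
  omega

open Classical in
theorem intrinsicVol_sub_eq_sum (hv : ∀ i, v i ≠ 0) (hpos : ∃ i, 0 < v i)
    (hneg : ∃ i, v i < 0) {k : ℕ} (hk : 1 ≤ k) (hkn : k ≤ n - 1) :
    intrinsicVol (spanOrthant v) (n - k) =
      ∑ S : Finset (Fin n) with IsMixed v S ∧ S.card = k + 1,
        (stdGaussian (EuclideanSpace ℝ (Fin n))).real (projRegion v S) := by
  rw [intrinsicVol_eq_sum hv]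
  refine Finset.sum_congr ?_ fun S hS => ?_
  · ext S
    simp only [Finset.mem_filter, Finset.mem_univ, true_and]
    have h2 := S.card_le_univ
    rw [Fintype.card_fin] at h2
    constructor
    · rintro ⟨rfl | h, h'⟩
      · simp at h'; omega
      · have := h.two_le_card
        exact ⟨h, by omega⟩
    · rintro ⟨h, h'⟩
      exact ⟨Or.inr h, by omega⟩
  · simp only [Finset.mem_filter, Finset.mem_univ, true_and] at hS
    simp only [nearest_mem_coneFaceRel_iff hv hpos hneg hS.1.nonempty, Set.ofPred_mem_eq]

/-- Every point projects into the relative interior of exactly one face. -/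
theorem sum_intrinsicVol (hv : ∀ i, v i ≠ 0) (hpos : ∃ i, 0 < v i) (hneg : ∃ i, v i < 0) :
    ∑ k ∈ Finset.range (n + 1), intrinsicVol (spanOrthant v) k = 1 := by
  classical
  set U : Finset (Fin n) → Set (EuclideanSpace ℝ (Fin n)) :=
    fun S => {g | nearest (spanOrthant v) g ∈ coneFaceRel v S} with hU
  have hne : (spanOrthant v).Nonempty := by
    rw [spanOrthant_eq_coneFace]; exact ⟨0, zero_mem_coneFace⟩
  have hmem (g) : nearest (spanOrthant v) g ∈ spanOrthant v :=
    ((nearest_eq_iff hne (isClosed_spanOrthant hv hpos hneg) convex_spanOrthant g _).1 rfl).1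
  set A : Finset (Finset (Fin n)) := {S | S = ∅ ∨ IsMixed v S} with hA
  have hAmem (S) : S ∈ A ↔ S = ∅ ∨ IsMixed v S := by simp [hA]
  have hdisj : Set.PairwiseDisjoint (A : Set (Finset (Fin n))) U := by
    intro S hS T hT hST
    refine Set.disjoint_left.2 fun g hgS hgT => hST ?_
    exact eq_of_mem_coneFaceRel ((hAmem S).1 hS) ((hAmem T).1 hT) hgS hgT
  have hcover : ⋃ S ∈ A, U S = Set.univ := by
    refine Set.eq_univ_of_forall fun g => ?_
    obtain ⟨S, hS, hg⟩ := exists_mem_coneFaceRel hv hpos hneg (hmem g)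
    exact Set.mem_biUnion ((hAmem S).2 hS) hg
  have hmixed (S) (hS : S.Nonempty) : MeasurableSet (U S) := by
    have : U S = projRegion v S := by
      ext g; exact nearest_mem_coneFaceRel_iff hv hpos hneg hS g
    rw [this]; exact measurableSet_projRegion
  -- the region of the cone itself is measurable as the complement of the other regions
  have hempty : MeasurableSet (U ∅) := by
    have : U ∅ = (⋃ S ∈ A.erase ∅, U S)ᶜ := by
      ext g
      rw [Set.mem_compl_iff]
      constructor
      · intro hg hg'
        simp only [Set.mem_iUnion] at hg'
        obtain ⟨S, hS, hgS⟩ := hg'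
        rw [Finset.mem_erase, hAmem] at hS
        exact hS.1 (eq_of_mem_coneFaceRel hS.2 (Or.inl rfl) hgS hg)
      · intro hg
        obtain ⟨S, hS, hgS⟩ := exists_mem_coneFaceRel hv hpos hneg (hmem g)
        by_cases h : S = ∅
        · subst h; exact hgS
        · refine (hg ?_).elim
          simp only [Set.mem_iUnion]
          exact ⟨S, Finset.mem_erase.2 ⟨h, (hAmem S).2 hS⟩, hgS⟩
    rw [this]
    exact (Finset.measurableSet_biUnion _ fun S hS =>
      hmixed S (Finset.nonempty_iff_ne_empty.2 (Finset.ne_of_mem_erase hS))).compl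
  have hmeas (S) (_ : S ∈ A) : MeasurableSet (U S) := by
    rcases S.eq_empty_or_nonempty with rfl | h
    exacts [hempty, hmixed S h]
  have htotal : ∑ S ∈ A, (stdGaussian (EuclideanSpace ℝ (Fin n))).real (U S) = 1 := by
    rw [← measureReal_biUnion_finset hdisj hmeas, hcover, probReal_univ]
  rw [← htotal, ← Finset.sum_fiberwise_of_maps_to (s := A) (t := Finset.range (n + 1))
    (g := fun S => n - (S.card - 1)) fun S _ => by
      rw [Finset.mem_range]; omega]
  refine Finset.sum_congr rfl fun k _ => ?_
  rw [intrinsicVol_eq_sum hv, hA, Finset.filter_filter]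

theorem intrinsicVol_top (hv : ∀ i, v i ≠ 0) (hpos : ∃ i, 0 < v i) (hneg : ∃ i, v i < 0) :
    intrinsicVol (spanOrthant v) n =
      1 - ∑ k ∈ Finset.range n, intrinsicVol (spanOrthant v) k := by
  rw [← sum_intrinsicVol hv hpos hneg, Finset.sum_range_succ]
  ring

end Volumes

/-! ### The complex Gaussian distribution function -/

section ComplexPhi

open Set Complex

/-- A Gaussian bound in `t`, uniform for `s` in bounded sets; half of the exponent `-t² / 2` absorbs
the mixed term. -/
theorem norm_cexp_neg_add_mul_sq_le (z : ℂ) (t s : ℝ) :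
    ‖cexp (-((t : ℂ) + s * z) ^ 2 / 2)‖ ≤
      Real.exp (-(1 / 4) * t ^ 2) * Real.exp (s ^ 2 * ‖z‖ ^ 2) := by
  rw [Complex.norm_exp, ← Real.exp_add]
  apply Real.exp_le_exp.2
  have h1 : (-((t : ℂ) + s * z) ^ 2 / 2).re = -((t + s * z.re) ^ 2 - (s * z.im) ^ 2) / 2 := by
    rw [show -((t : ℂ) + s * z) ^ 2 / 2 = ((1 / 2 : ℝ) : ℂ) * (-((t : ℂ) + s * z) ^ 2) by
      push_cast; ring, Complex.re_ofReal_mul]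
    simp [sq]
    ring
  have h2 : ‖z‖ ^ 2 = z.re ^ 2 + z.im ^ 2 := by rw [Complex.sq_norm, Complex.normSq_apply]; ring
  rw [h1, h2]
  nlinarith [sq_nonneg (t / 2 + s * z.re), sq_nonneg (s * z.im), sq_nonneg (t + 2 * (s * z.re))]

theorem integrable_cexp_neg_add_mul_sq (z : ℂ) (s : ℝ) :
    Integrable fun t : ℝ => cexp (-((t : ℂ) + s * z) ^ 2 / 2) := by
  refine Integrable.mono' ((integrable_exp_neg_mul_sq (by norm_num : (0 : ℝ) < 1 / 4)).mul_const
    (Real.exp (s ^ 2 * ‖z‖ ^ 2))) (by fun_prop) (ae_of_all _ fun t => ?_)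
  exact norm_cexp_neg_add_mul_sq_le z t s

theorem integrable_add_abs_mul_exp (c d : ℝ) :
    Integrable fun t : ℝ => c * (|t| + d) * Real.exp (-(1 / 4) * t ^ 2) := by
  have h1 : Integrable fun t : ℝ => |t| * Real.exp (-(1 / 4) * t ^ 2) := by
    have := (integrable_mul_exp_neg_mul_sq (by norm_num : (0 : ℝ) < 1 / 4)).abs
    simpa only [abs_mul, Real.abs_exp] using this
  have h2 := (integrable_exp_neg_mul_sq (by norm_num : (0 : ℝ) < 1 / 4)).const_mul d
  convert! (h1.add h2).const_mul c using 1
  ext t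
  simp only [Pi.add_apply]
  ring

theorem norm_deriv_cexp_le (z : ℂ) {r s : ℝ} (hs : |s| ≤ r) (t : ℝ) :
    ‖z * (-((t : ℂ) + s * z) * cexp (-((t : ℂ) + s * z) ^ 2 / 2))‖ ≤
      ‖z‖ * Real.exp (r ^ 2 * ‖z‖ ^ 2) * (|t| + r * ‖z‖) * Real.exp (-(1 / 4) * t ^ 2) := by
  have h1 := norm_cexp_neg_add_mul_sq_le z t s
  have h2 : ‖-((t : ℂ) + s * z)‖ ≤ |t| + r * ‖z‖ := by
    rw [norm_neg]
    refine (norm_add_le _ _).trans ?_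
    rw [norm_mul, Complex.norm_real, Complex.norm_real, Real.norm_eq_abs, Real.norm_eq_abs]
    gcongr
  have h3 : s ^ 2 ≤ r ^ 2 := sq_le_sq' (neg_le_of_abs_le hs) (le_of_abs_le hs)
  rw [norm_mul, norm_mul]
  calc ‖z‖ * (‖-((t : ℂ) + s * z)‖ * ‖cexp (-((t : ℂ) + s * z) ^ 2 / 2)‖)
      ≤ ‖z‖ * ((|t| + r * ‖z‖) *
          (Real.exp (-(1 / 4) * t ^ 2) * Real.exp (r ^ 2 * ‖z‖ ^ 2))) := by
        have h4 : ‖cexp (-((t : ℂ) + s * z) ^ 2 / 2)‖ ≤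
            Real.exp (-(1 / 4) * t ^ 2) * Real.exp (r ^ 2 * ‖z‖ ^ 2) := h1.trans (by gcongr)
        have h5 : 0 ≤ |t| + r * ‖z‖ := (norm_nonneg _).trans h2
        gcongr
    _ = _ := by ring

/-- The derivative in `s` of the integrand is `z` times its derivative in `t`, so integrating it
over the half-line leaves the boundary term at `t = 0`. -/
theorem hasDerivAt_integral_Iic_cexp (z : ℂ) (s : ℝ) :
    HasDerivAt (fun s : ℝ => ∫ t in Iic (0 : ℝ), cexp (-((t : ℂ) + s * z) ^ 2 / 2))
      (z * cexp (-((s : ℂ) * z) ^ 2 / 2)) s := by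
  have hd_s (t x : ℝ) : HasDerivAt (fun x : ℝ => cexp (-((t : ℂ) + x * z) ^ 2 / 2))
      (z * (-((t : ℂ) + x * z) * cexp (-((t : ℂ) + x * z) ^ 2 / 2))) x := by
    have h1 : HasDerivAt (fun x : ℝ => (t : ℂ) + x * z) z x := by
      simpa using ((hasDerivAt_id x).ofReal_comp.mul_const z).const_add (t : ℂ)
    convert! (((h1.pow 2).neg).div_const 2).cexp using 1
    simp
    ring
  have hd_t (t : ℝ) : HasDerivAt (fun t : ℝ => z * cexp (-((t : ℂ) + s * z) ^ 2 / 2))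
      (z * (-((t : ℂ) + s * z) * cexp (-((t : ℂ) + s * z) ^ 2 / 2))) t := by
    have h1 : HasDerivAt (fun t : ℝ => (t : ℂ) + s * z) 1 t := by
      simpa using (hasDerivAt_id t).ofReal_comp.add_const ((s : ℂ) * z)
    convert! ((((h1.pow 2).neg).div_const 2).cexp).const_mul z using 1
    simp only [Pi.neg_apply, Pi.pow_apply]
    push_cast
    ring
  have hint' : Integrable fun t : ℝ =>
      z * (-((t : ℂ) + s * z) * cexp (-((t : ℂ) + s * z) ^ 2 / 2)) :=
    Integrable.mono' (integrable_add_abs_mul_exp _ _) (by fun_prop)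
      (ae_of_all _ fun t => norm_deriv_cexp_le z le_rfl t)
  have hmain := (hasDerivAt_integral_of_dominated_loc_of_deriv_le
    (μ := volume.restrict (Iic (0 : ℝ)))
    (F := fun (s t : ℝ) => cexp (-((t : ℂ) + s * z) ^ 2 / 2))
    (F' := fun (s t : ℝ) => z * (-((t : ℂ) + s * z) * cexp (-((t : ℂ) + s * z) ^ 2 / 2)))
    (x₀ := s) (s := Metric.ball s 1) (Metric.ball_mem_nhds s one_pos)
    (bound := fun t => ‖z‖ * Real.exp ((|s| + 1) ^ 2 * ‖z‖ ^ 2) * (|t| + (|s| + 1) * ‖z‖) *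
      Real.exp (-(1 / 4) * t ^ 2))
    (Filter.Eventually.of_forall fun x => by fun_prop)
    (integrable_cexp_neg_add_mul_sq z s).integrableOn (by fun_prop)
    (ae_of_all _ fun t x hx => norm_deriv_cexp_le z (by
      have h1 : |x - s| < 1 := by simpa [Real.dist_eq] using hx
      have h2 := abs_sub_abs_le_abs_sub x s
      linarith) t)
    (integrable_add_abs_mul_exp _ _).integrableOn
    (ae_of_all _ fun t x _ => hd_s t x)).2
  have htend : Filter.Tendsto (fun t : ℝ => z * cexp (-((t : ℂ) + s * z) ^ 2 / 2)) Filter.atBot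
      (nhds 0) :=
    tendsto_zero_of_hasDerivAt_of_integrableOn_Iic (a := 0) (fun t _ => hd_t t) hint'.integrableOn
      ((integrable_cexp_neg_add_mul_sq z s).const_mul z).integrableOn
  rw [integral_Iic_of_hasDerivAt_of_tendsto' (fun t _ => hd_t t) hint'.integrableOn htend]
    at hmain
  simpa using hmain

/-- `Φ(z)` as the Gaussian integral over the shifted half-line `z + (-∞, 0]`. -/
theorem cPhi_eq_integral_Iic (z : ℂ) :
    cPhi z = 1 / (Real.sqrt (2 * Real.pi) : ℂ) *
      ∫ t in Iic (0 : ℝ), cexp (-((t : ℂ) + z) ^ 2 / 2) := by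
  have hftc := intervalIntegral.integral_eq_sub_of_hasDerivAt (a := 0) (b := 1)
    (fun s _ => hasDerivAt_integral_Iic_cexp z s)
    (Continuous.intervalIntegrable (by fun_prop) _ _)
  have h0 : ∫ t in Iic (0 : ℝ), cexp (-((t : ℂ) + ((0 : ℝ) : ℂ) * z) ^ 2 / 2) =
      (Real.sqrt (2 * Real.pi) : ℂ) / 2 := by
    have h1 := integral_gaussian_Ioi (1 / 2)
    rw [show Real.pi / (1 / 2) = 2 * Real.pi by ring] at h1
    have h2 : ∫ t in Iic (0 : ℝ), Real.exp (-(1 / 2) * t ^ 2) = √(2 * Real.pi) / 2 := by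
      rw [← h1, ← neg_zero, ← integral_comp_neg_Iic]
      simp
    have h3 := congrArg (fun x : ℝ => (x : ℂ)) h2
    simp only [← integral_complex_ofReal] at h3
    push_cast at h3
    rw [← h3]
    refine integral_congr_ae (ae_of_all _ fun t => ?_)
    simp only
    congr 1
    push_cast
    ring
  have hne : (Real.sqrt (2 * Real.pi) : ℂ) ≠ 0 := by
    have : 0 < Real.sqrt (2 * Real.pi) := by positivity
    exact_mod_cast this.ne'
  rw [cPhi, hftc, h0]
  field_simp
  simp

theorem continuous_cPhi : Continuous cPhi := by
  unfold cPhi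
  refine continuous_const.add (continuous_const.mul ?_)
  apply intervalIntegral.continuous_parametric_intervalIntegral_of_continuous'
  fun_prop

/-- On the real line `Φ` is the distribution function of the standard normal law. -/
theorem cPhi_ofReal (x : ℝ) : cPhi x = ((gaussianReal 0 1).real (Iic x) : ℂ) := by
  rw [cPhi_eq_integral_Iic, measureReal_def, gaussianReal_apply_eq_integral _ one_ne_zero,
    ENNReal.toReal_ofReal (integral_nonneg fun _ => gaussianPDFReal_nonneg _ _ _),
    ← integral_complex_ofReal, ← integral_const_mul]
  have h := (measurePreserving_add_right volume x).setIntegral_preimage_emb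
    (measurableEmbedding_addRight x) (fun t : ℝ => ((gaussianPDFReal 0 1 t : ℝ) : ℂ)) (Iic x)
  rw [← h]
  have : (fun t : ℝ => t + x) ⁻¹' Iic x = Iic 0 := by ext; simp
  rw [this]
  refine integral_congr_ae (ae_of_all _ fun t => ?_)
  simp only [gaussianPDFReal, NNReal.coe_one]
  push_cast
  rw [one_div, mul_one, mul_one, sub_zero]

/-- On the imaginary axis `Φ` is, up to a Gaussian factor, the Fourier transform of the standard
normal density restricted to the negative half-line. -/
theorem cPhi_I_mul (x : ℝ) :
    cexp (-(x : ℂ) ^ 2 / 2) * cPhi (I * x) =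
      ∫ t, (Iic (0 : ℝ)).indicator (fun t : ℝ => cexp (-(t * x) * I)) t ∂(gaussianReal 0 1) := by
  rw [integral_gaussianReal_eq_integral_smul one_ne_zero, cPhi_eq_integral_Iic, ← mul_assoc,
    ← integral_const_mul, ← integral_indicator measurableSet_Iic]
  refine integral_congr_ae (ae_of_all _ fun t => ?_)
  simp only [indicator]
  split_ifs
  · simp only [gaussianPDFReal, NNReal.coe_one, Complex.real_smul]
    push_cast
    rw [one_div, mul_one, mul_one, sub_zero, mul_comm (cexp _) _, mul_assoc, mul_assoc,
      ← Complex.exp_add, ← Complex.exp_add]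
    congr 2
    linear_combination (-(x : ℂ) ^ 2 / 2) * I_sq
  · simp

/-- The growth of `Φ` on the imaginary axis. The factor `(1 + |x|)⁻¹` is what makes products of at
least two values integrable against the Gaussian density. -/
theorem norm_cPhi_I_mul_le (x : ℝ) :
    ‖cPhi (I * x)‖ ≤ 7 * Real.exp (x ^ 2 / 2) * (1 + |x|)⁻¹ := by
  set q := ∫ s in (0 : ℝ)..1, Real.exp (s ^ 2 * x ^ 2 / 2) with hq
  set e := Real.exp (x ^ 2 / 2) with he
  have hI (f : ℝ → ℝ) (hf : Continuous f) : IntervalIntegrable f volume 0 1 :=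
    hf.intervalIntegrable _ _
  have hq0 : 0 ≤ q := intervalIntegral.integral_nonneg zero_le_one fun s _ => (Real.exp_pos _).le
  have hq1 : q ≤ e := by
    have : q ≤ ∫ s in (0 : ℝ)..1, e :=
      intervalIntegral.integral_mono_on zero_le_one (hI _ (by fun_prop)) (hI _ (by fun_prop))
        fun s hs => Real.exp_le_exp.2 (by
          have : s ^ 2 ≤ 1 := pow_le_one₀ hs.1 hs.2
          nlinarith [sq_nonneg x])
    simpa using this
  have hq2 : x ^ 2 * q ≤ 2 * e := by
    -- replacing `s ^ 2` by `s` makes the integral elementary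
    have h1 : q ≤ ∫ s in (0 : ℝ)..1, Real.exp (s * (x ^ 2 / 2)) :=
      intervalIntegral.integral_mono_on zero_le_one (hI _ (by fun_prop)) (hI _ (by fun_prop))
        fun s hs => Real.exp_le_exp.2 (by
          have : s ^ 2 ≤ s := by nlinarith [hs.1, hs.2]
          nlinarith [mul_le_mul_of_nonneg_right this (sq_nonneg x)])
    have h2 : ∫ s in (0 : ℝ)..1, x ^ 2 / 2 * Real.exp (s * (x ^ 2 / 2)) = e - 1 := by
      have := intervalIntegral.integral_eq_sub_of_hasDerivAt (a := 0) (b := 1)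
        (f := fun s : ℝ => Real.exp (s * (x ^ 2 / 2)))
        (f' := fun s : ℝ => x ^ 2 / 2 * Real.exp (s * (x ^ 2 / 2)))
        (fun s _ => by
          have := ((hasDerivAt_id s).mul_const (x ^ 2 / 2)).exp
          simpa [mul_comm] using this) (hI _ (by fun_prop))
      rw [this]; simp [he]
    rw [intervalIntegral.integral_const_mul] at h2
    nlinarith [sq_nonneg x, mul_le_mul_of_nonneg_left h1 (by positivity : 0 ≤ x ^ 2 / 2)]
  have he1 : 1 + x ^ 2 / 2 ≤ e := by
    have := Real.add_one_le_exp (x ^ 2 / 2); linarith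
  have hb : ‖cPhi (I * x)‖ ≤ 1 / 2 + |x| * q := by
    rw [cPhi]
    refine (norm_add_le _ _).trans ?_
    have h1 : ‖(1 / 2 : ℂ)‖ = 1 / 2 := by norm_num
    rw [h1, norm_mul]
    refine add_le_add le_rfl ?_
    have h2 : ‖(1 / (Real.sqrt (2 * Real.pi) : ℂ))‖ ≤ 1 := by
      rw [norm_div, norm_one, Complex.norm_real, Real.norm_of_nonneg (Real.sqrt_nonneg _)]
      apply div_le_one_of_le₀ _ (Real.sqrt_nonneg _)
      exact Real.one_le_sqrt.2 (by linarith [Real.two_le_pi])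
    have h3 : ‖∫ s in (0 : ℝ)..1, I * x * cexp (-((s : ℂ) * (I * x)) ^ 2 / 2)‖ ≤ |x| * q := by
      rw [hq, ← intervalIntegral.integral_const_mul]
      refine intervalIntegral.norm_integral_le_of_norm_le zero_le_one
        (Filter.Eventually.of_forall fun s _ => ?_) (hI _ (by fun_prop))
      rw [norm_mul, norm_mul, norm_I, one_mul, Complex.norm_real, Real.norm_eq_abs]
      have : -((s : ℂ) * (I * x)) ^ 2 / 2 = ((s ^ 2 * x ^ 2 / 2 : ℝ) : ℂ) := by
        push_cast
        linear_combination (-(s : ℂ) ^ 2 * x ^ 2 / 2) * I_sq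
      rw [this, Complex.norm_exp_ofReal]
    calc _ ≤ 1 * (|x| * q) := by gcongr
      _ = _ := one_mul _
  rw [← div_eq_mul_inv, le_div_iff₀ (by positivity)]
  refine (mul_le_mul_of_nonneg_right hb (by positivity)).trans ?_
  have hx2 : |x| ^ 2 = x ^ 2 := sq_abs x
  nlinarith [abs_nonneg x, sq_nonneg (|x| - 1), mul_nonneg hq0 (sq_nonneg (|x| - 1))]

end ComplexPhi

/-! ### Resampling one component of a Gaussian vector -/

section Resampling

variable {E : Type*} [NormedAddCommGroup E] [InnerProductSpace ℝ E]

/-- The vector `x` with its component along the unit vector `w` replaced by `s`. -/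
noncomputable def replaceComponent (w x : E) (s : ℝ) : E := x - inner ℝ w x • w + s • w

theorem continuous_replaceComponent (w : E) :
    Continuous fun p : E × ℝ => replaceComponent w p.1 p.2 := by
  unfold replaceComponent
  fun_prop

theorem inner_replaceComponent {w : E} (hw : ‖w‖ = 1) (x : E) (s : ℝ) :
    inner ℝ w (replaceComponent w x s) = s := by
  simp [replaceComponent, inner_add_right, inner_sub_right, inner_smul_right, hw]

variable [FiniteDimensional ℝ E] [MeasurableSpace E] [BorelSpace E]

/-- Replacing the component of a standard Gaussian vector along a unit vector by an independent
standard normal variable does not change its law. -/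
theorem map_replaceComponent_stdGaussian {w : E} (hw : ‖w‖ = 1) :
    ((stdGaussian E).prod (gaussianReal 0 1)).map (fun p => replaceComponent w p.1 p.2) =
      stdGaussian E := by
  have hmeas : Measurable fun p : E × ℝ => replaceComponent w p.1 p.2 :=
    (continuous_replaceComponent w).measurable
  have : IsProbabilityMeasure
      (((stdGaussian E).prod (gaussianReal 0 1)).map fun p => replaceComponent w p.1 p.2) :=
    Measure.isProbabilityMeasure_map hmeas.aemeasurable
  apply Measure.ext_of_charFun
  ext t
  rw [charFun_apply, integral_map hmeas.aemeasurable (by fun_prop), charFun_stdGaussian]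
  have h1 (p : E × ℝ) : inner ℝ (replaceComponent w p.1 p.2) t =
      inner ℝ p.1 (t - inner ℝ w t • w) + p.2 * inner ℝ w t := by
    simp only [replaceComponent, inner_add_left, inner_sub_left, inner_smul_left, inner_sub_right,
      inner_smul_right, real_inner_comm]
    simp
    ring
  simp only [h1, Complex.ofReal_add, add_mul, Complex.exp_add]
  rw [integral_prod_mul (μ := stdGaussian E) (ν := gaussianReal 0 1)
    (fun x : E => Complex.exp (((inner ℝ x (t - inner ℝ w t • w) : ℝ) : ℂ) * Complex.I))
    (fun s : ℝ => Complex.exp (((s * inner ℝ w t : ℝ) : ℂ) * Complex.I)), ← charFun_apply,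
    charFun_stdGaussian]
  have h2 := charFun_apply_real (μ := gaussianReal 0 1) (inner ℝ w t)
  rw [charFun_gaussianReal] at h2
  have h3 : ∫ s, Complex.exp (((s * inner ℝ w t : ℝ) : ℂ) * Complex.I) ∂(gaussianReal 0 1) =
      Complex.exp (-(((inner ℝ w t : ℝ) : ℂ)) ^ 2 / 2) := by
    have h4 : Complex.exp (-(((inner ℝ w t : ℝ) : ℂ)) ^ 2 / 2) =
        ∫ s, Complex.exp ((inner ℝ w t : ℝ) * (s : ℂ) * Complex.I) ∂(gaussianReal 0 1) := by
      rw [← h2]; congr 1; simp; ring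
    rw [h4]
    refine integral_congr_ae (ae_of_all _ fun s => ?_)
    simp only
    push_cast
    ring_nf
  rw [h3, ← Complex.exp_add]
  congr 1
  have h5 : ‖t - inner ℝ w t • w‖ ^ 2 = ‖t‖ ^ 2 - (inner ℝ w t) ^ 2 := by
    rw [norm_sub_sq_real, norm_smul, hw, inner_smul_right, real_inner_comm]
    simp
    ring
  have h6 : (‖t - inner ℝ w t • w‖ : ℂ) ^ 2 = ‖t‖ ^ 2 - ((inner ℝ w t : ℝ) : ℂ) ^ 2 := by
    exact_mod_cast h5
  rw [h6]
  ring

theorem stdGaussian_map_inner {w : E} (hw : ‖w‖ = 1) :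
    (stdGaussian E).map (fun x => inner ℝ w x) = gaussianReal 0 1 := by
  have hmeas : Measurable fun p : E × ℝ => replaceComponent w p.1 p.2 :=
    (continuous_replaceComponent w).measurable
  rw [← map_replaceComponent_stdGaussian hw, Measure.map_map (by fun_prop) hmeas]
  have : ((fun x => inner ℝ w x) ∘ fun p : E × ℝ => replaceComponent w p.1 p.2) = Prod.snd := by
    ext p; exact inner_replaceComponent hw p.1 p.2
  rw [this, ← Measure.snd, Measure.snd_prod]

theorem stdGaussian_hyperplane {u : E} (hu : u ≠ 0) :
    stdGaussian E {x | inner ℝ u x = 0} = 0 := by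
  have hu' : ‖u‖ ≠ 0 := norm_ne_zero_iff.2 hu
  have hw : ‖‖u‖⁻¹ • u‖ = 1 := norm_smul_inv_norm (𝕜 := ℝ) hu
  have h1 : {x | inner ℝ u x = 0} = (fun x => inner ℝ (‖u‖⁻¹ • u) x) ⁻¹' {0} := by
    ext x
    simp [inner_smul_left, hu]
  rw [h1, ← Measure.map_apply (by fun_prop) (measurableSet_singleton 0),
    stdGaussian_map_inner hw]
  have := nullSingletonClass_gaussianReal (μ := 0) (v := 1) one_ne_zero
  exact measure_singleton 0

end Resampling

/-! ### The Gaussian expectation of a product of values of `Φ` on the imaginary axis -/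

section Inversion

open Set Complex
open scoped FourierTransform

variable {n : ℕ} {S : Finset (Fin n)} {w : EuclideanSpace ℝ (Fin n)}

theorem inner_eq_sum_of_support (hoff : ∀ j ∉ S, w j = 0) (x : EuclideanSpace ℝ (Fin n)) :
    inner ℝ w x = ∑ j ∈ S, x j * w j := by
  rw [PiLp.inner_apply]
  simp only [RCLike.inner_apply, conj_trivial]
  exact (Finset.sum_subset (Finset.subset_univ S) fun j _ hj => by simp [hoff j hj]).symm

theorem sum_sq_eq_one_of_support (hw : ‖w‖ = 1) (hoff : ∀ j ∉ S, w j = 0) :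
    ∑ j ∈ S, w j ^ 2 = 1 := by
  rw [Finset.sum_subset (Finset.subset_univ S) fun j _ hj => by simp [hoff j hj],
    ← EuclideanSpace.real_norm_sq_eq, hw, one_pow]

theorem measurableSet_orthant :
    MeasurableSet {x : EuclideanSpace ℝ (Fin n) | ∀ j ∈ S, x j ≤ 0} := by
  have : {x : EuclideanSpace ℝ (Fin n) | ∀ j ∈ S, x j ≤ 0} = ⋂ j ∈ S, {x | x j ≤ 0} := by
    ext; simp
  rw [this]
  exact Finset.measurableSet_biInter _ fun j _ =>
    (isClosed_le (by fun_prop) (by fun_prop)).measurableSet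

theorem continuous_prod_cPhi_I_mul (S : Finset (Fin n)) (w : Fin n → ℝ) :
    Continuous fun a : ℝ => ∏ j ∈ S, cPhi (I * ((a * w j : ℝ) : ℂ)) :=
  continuous_finsetProd _ fun j _ => continuous_cPhi.comp (by fun_prop)

/-- The product of `|S| ≥ 2` factors decays like `a ^ (-|S|)`. -/
theorem integrable_exp_mul_prod_cPhi {w : Fin n → ℝ} (hne : ∀ j ∈ S, w j ≠ 0)
    (hnorm : ∑ j ∈ S, w j ^ 2 = 1) (hcard : 2 ≤ S.card) :
    Integrable fun a : ℝ => cexp (-(a : ℂ) ^ 2 / 2) * ∏ j ∈ S, cPhi (I * ((a * w j : ℝ) : ℂ)) := by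
  have hSne : S.Nonempty := Finset.card_pos.1 (by omega)
  -- the smallest `|w j|` gives a common lower bound for all factors
  obtain ⟨i, hi, hmin⟩ := Finset.exists_min_image S (fun j => |w j|) hSne
  set c := |w i| with hc
  have hc0 : 0 < c := abs_pos.2 (hne i hi)
  have hdom : Integrable fun a : ℝ => 7 ^ S.card * (1 + (c * a) ^ 2)⁻¹ :=
    (integrable_inv_one_add_sq.comp_mul_left' hc0.ne').const_mul _
  refine Integrable.mono' hdom ?_ (ae_of_all _ fun a => ?_)
  · have := continuous_prod_cPhi_I_mul S w
    exact Continuous.aestronglyMeasurable (by fun_prop)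
  · have h1 : ‖cexp (-(a : ℂ) ^ 2 / 2)‖ = Real.exp (-(a ^ 2 / 2)) := by
      rw [show -(a : ℂ) ^ 2 / 2 = ((-(a ^ 2 / 2) : ℝ) : ℂ) by push_cast; ring,
        Complex.norm_exp_ofReal]
    have h2 : ∏ j ∈ S, Real.exp ((a * w j) ^ 2 / 2) = Real.exp (a ^ 2 / 2) := by
      rw [← Real.exp_sum]
      congr 1
      simp only [mul_pow, ← Finset.sum_div, ← Finset.mul_sum, hnorm, mul_one]
    have h3 : ∏ j ∈ S, (1 + |a * w j|)⁻¹ ≤ (1 + (c * a) ^ 2)⁻¹ := by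
      have hca : 0 ≤ c * |a| := by positivity
      calc ∏ j ∈ S, (1 + |a * w j|)⁻¹ ≤ ∏ _j ∈ S, (1 + c * |a|)⁻¹ := by
            refine Finset.prod_le_prod (fun j _ => by positivity) fun j hj => ?_
            have := hmin j hj
            rw [abs_mul, mul_comm |a|]
            gcongr
        _ = ((1 + c * |a|)⁻¹) ^ S.card := by rw [Finset.prod_const]
        _ ≤ ((1 + c * |a|)⁻¹) ^ 2 := by
            refine pow_le_pow_of_le_one (by positivity) ?_ hcard
            exact inv_le_one_of_one_le₀ (by linarith)
        _ ≤ (1 + (c * a) ^ 2)⁻¹ := by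
            rw [inv_pow]
            gcongr
            rw [mul_pow, ← sq_abs a]
            nlinarith
    rw [norm_mul, norm_prod, h1]
    calc Real.exp (-(a ^ 2 / 2)) * ∏ j ∈ S, ‖cPhi (I * ((a * w j : ℝ) : ℂ))‖
        ≤ Real.exp (-(a ^ 2 / 2)) *
            ∏ j ∈ S, (7 * Real.exp ((a * w j) ^ 2 / 2) * (1 + |a * w j|)⁻¹) := by
          gcongr with j hj
          exact norm_cPhi_I_mul_le _
      _ = 7 ^ S.card * ∏ j ∈ S, (1 + |a * w j|)⁻¹ := by
          rw [Finset.prod_mul_distrib, Finset.prod_mul_distrib, h2, Finset.prod_const]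
          have : Real.exp (-(a ^ 2 / 2)) * Real.exp (a ^ 2 / 2) = 1 := by
            rw [← Real.exp_add]; simp
          linear_combination 7 ^ S.card * (∏ j ∈ S, (1 + |a * w j|)⁻¹) * this
      _ ≤ _ := by gcongr

theorem gaussianPDFReal_std (a : ℝ) :
    ((gaussianPDFReal 0 1 a : ℝ) : ℂ) =
      (Real.sqrt (2 * Real.pi) : ℂ)⁻¹ * cexp (-(a : ℂ) ^ 2 / 2) := by
  simp [gaussianPDFReal]

theorem integrable_prod_cPhi_I_mul {w : Fin n → ℝ} (hne : ∀ j ∈ S, w j ≠ 0)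
    (hnorm : ∑ j ∈ S, w j ^ 2 = 1) (hcard : 2 ≤ S.card) :
    Integrable (fun a : ℝ => ∏ j ∈ S, cPhi (I * ((a * w j : ℝ) : ℂ))) (gaussianReal 0 1) := by
  rw [gaussianReal_of_var_ne_zero _ one_ne_zero,
    integrable_withDensity_iff_integrable_smul' (measurable_gaussianPDF _ _)
      (ae_of_all _ fun _ => gaussianPDF_lt_top)]
  refine ((integrable_exp_mul_prod_cPhi hne hnorm hcard).const_mul
    (Real.sqrt (2 * Real.pi) : ℂ)⁻¹).congr (ae_of_all _ fun a => ?_)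
  simp only [toReal_gaussianPDF, Complex.real_smul, gaussianPDFReal_std]
  ring

theorem integral_gaussianReal_eq_cexp (F : ℝ → ℂ) :
    ∫ a, F a ∂(gaussianReal 0 1) =
      (Real.sqrt (2 * Real.pi) : ℂ)⁻¹ * ∫ a : ℝ, cexp (-(a : ℂ) ^ 2 / 2) * F a := by
  rw [integral_gaussianReal_eq_integral_smul one_ne_zero, ← integral_const_mul]
  refine integral_congr_ae (ae_of_all _ fun a => ?_)
  simp only [Complex.real_smul, gaussianPDFReal_std]
  ring

/-- The Fourier transform of the component along `w` of a standard Gaussian vector, restricted to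
the event that the coordinates in `S` are nonpositive; it factorizes over the coordinates. -/
theorem integral_indicator_orthant (hw : ∑ j ∈ S, w j ^ 2 = 1) (hoff : ∀ j ∉ S, w j = 0) (a : ℝ) :
    ∫ x, {x : EuclideanSpace ℝ (Fin n) | ∀ j ∈ S, x j ≤ 0}.indicator
        (fun x => cexp (-((a * inner ℝ w x : ℝ) : ℂ) * I)) x
        ∂(stdGaussian (EuclideanSpace ℝ (Fin n))) =
      cexp (-(a : ℂ) ^ 2 / 2) * ∏ j ∈ S, cPhi (I * ((a * w j : ℝ) : ℂ)) := by
  have hfac (x : Fin n → ℝ) :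
      {x : EuclideanSpace ℝ (Fin n) | ∀ j ∈ S, x j ≤ 0}.indicator
        (fun x => cexp (-((a * inner ℝ w x : ℝ) : ℂ) * I)) (WithLp.toLp 2 x) =
      ∏ j, (if j ∈ S then (Iic (0 : ℝ)).indicator
        (fun t : ℝ => cexp (-(t * ((a * w j : ℝ) : ℂ)) * I)) (x j) else 1) := by
    rw [Finset.prod_ite_mem, Finset.univ_inter]
    by_cases hx : ∀ j ∈ S, x j ≤ 0
    · rw [indicator_of_mem (show WithLp.toLp 2 x ∈ {x : EuclideanSpace ℝ (Fin n) |
        ∀ j ∈ S, x j ≤ 0} from hx), Finset.prod_congr rfl fun j hj =>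
        indicator_of_mem (show x j ∈ Iic (0 : ℝ) from hx j hj) _, ← Complex.exp_sum]
      congr 1
      rw [inner_eq_sum_of_support hoff]
      push_cast
      rw [Finset.mul_sum, ← Finset.sum_neg_distrib, Finset.sum_mul]
      exact Finset.sum_congr rfl fun j _ => by ring
    · rw [indicator_of_notMem (show WithLp.toLp 2 x ∉ {x : EuclideanSpace ℝ (Fin n) |
        ∀ j ∈ S, x j ≤ 0} from hx)]
      push Not at hx
      obtain ⟨j, hj, hxj⟩ := hx
      exact (Finset.prod_eq_zero hj (indicator_of_notMem
        (show x j ∉ Iic (0 : ℝ) from not_le.2 hxj) _)).symm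
  rw [← map_pi_eq_stdGaussian, integral_map (by fun_prop)
    (((by fun_prop : Measurable fun x : EuclideanSpace ℝ (Fin n) =>
      cexp (-((a * inner ℝ w x : ℝ) : ℂ) * I)).indicator
        measurableSet_orthant).aestronglyMeasurable)]
  simp only [hfac]
  rw [integral_fintype_prod_eq_prod (f := fun j (t : ℝ) => if j ∈ S then (Iic (0 : ℝ)).indicator
        (fun t : ℝ => cexp (-(t * ((a * w j : ℝ) : ℂ)) * I)) t else 1)]
  have hcoord (j : Fin n) : ∫ t, (if j ∈ S then (Iic (0 : ℝ)).indicator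
        (fun t : ℝ => cexp (-(t * ((a * w j : ℝ) : ℂ)) * I)) t else 1) ∂(gaussianReal 0 1) =
      if j ∈ S then cexp (-((a * w j : ℝ) : ℂ) ^ 2 / 2) * cPhi (I * ((a * w j : ℝ) : ℂ))
        else 1 := by
    split_ifs
    · rw [cPhi_I_mul]
    · simp
  simp only [hcoord]
  rw [Finset.prod_ite_mem, Finset.univ_inter, Finset.prod_mul_distrib, ← Complex.exp_sum]
  congr 2
  have : (∑ j ∈ S, (w j : ℂ) ^ 2) = 1 := by exact_mod_cast hw
  push_cast
  simp only [mul_pow, neg_div, Finset.sum_neg_distrib, ← Finset.sum_div, ← Finset.mul_sum, this,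
    mul_one]

theorem residual_coord (w x : EuclideanSpace ℝ (Fin n)) (j : Fin n) :
    x j - inner ℝ w x * w j = inner ℝ (EuclideanSpace.single j (1 : ℝ) - w j • w) x := by
  simp [inner_sub_left, inner_smul_left, EuclideanSpace.inner_single_left, mul_comm]

/-- No coordinate of the residual `x - ⟨w, x⟩ w` vanishes with positive probability. -/
theorem stdGaussian_residual_coord (hne : ∀ j ∈ S, w j ≠ 0) (hcard : 2 ≤ S.card) {j : Fin n}
    (hj : j ∈ S) :
    stdGaussian (EuclideanSpace ℝ (Fin n)) {x | x j - inner ℝ w x * w j = 0} = 0 := by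
  simp only [residual_coord]
  apply stdGaussian_hyperplane
  intro h
  obtain ⟨i, hi, hij⟩ := Finset.exists_mem_ne (s := S) (by omega) j
  have := congrArg (fun x : EuclideanSpace ℝ (Fin n) => x i) h
  simp [hij] at this
  exact this.elim (hne j hj) (hne i hi)

/-- The pairs `(x, s)` such that `x`, with its component along `w` replaced by `s`, has nonpositive
coordinates in `S`. -/
def orthantPairs (S : Finset (Fin n)) (w : EuclideanSpace ℝ (Fin n)) :
    Set (EuclideanSpace ℝ (Fin n) × ℝ) :=
  {p | ∀ j ∈ S, replaceComponent w p.1 p.2 j ≤ 0}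

theorem measurableSet_orthantPairs : MeasurableSet (orthantPairs S w) := by
  have : orthantPairs S w = ⋂ j ∈ S, {p | replaceComponent w p.1 p.2 j ≤ 0} := by
    ext; simp [orthantPairs]
  rw [this]
  have := continuous_replaceComponent w
  exact Finset.measurableSet_biInter _ fun j _ =>
    (isClosed_le (by fun_prop) (by fun_prop)).measurableSet

/-- The probability that a standard Gaussian vector has nonpositive coordinates in `S`, given that
its component along `w` is `s`. -/
noncomputable def orthantProb (S : Finset (Fin n)) (w : EuclideanSpace ℝ (Fin n)) (s : ℝ) : ℝ :=
  (stdGaussian (EuclideanSpace ℝ (Fin n))).real {x | (x, s) ∈ orthantPairs S w}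

theorem measurable_orthantProb : Measurable (orthantProb S w) :=
  (measurable_measure_prodMk_right (μ := stdGaussian (EuclideanSpace ℝ (Fin n)))
    measurableSet_orthantPairs).ennreal_toReal

theorem orthantProb_mem_Icc (s : ℝ) : orthantProb S w s ∈ Icc (0 : ℝ) 1 :=
  ⟨measureReal_nonneg, measureReal_le_one⟩

theorem orthantProb_eq_integral (s : ℝ) :
    orthantProb S w s = ∫ x, (orthantPairs S w).indicator 1 (x, s)
      ∂(stdGaussian (EuclideanSpace ℝ (Fin n))) := by
  have hm : MeasurableSet {x | (x, s) ∈ orthantPairs S w} :=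
    measurable_prodMk_right measurableSet_orthantPairs
  rw [orthantProb, ← integral_indicator_one hm]
  rfl

theorem replaceComponent_apply (x : EuclideanSpace ℝ (Fin n)) (s : ℝ) (j : Fin n) :
    replaceComponent w x s j = x j - inner ℝ w x * w j + s * w j := by
  simp [replaceComponent]

theorem orthantProb_zero :
    orthantProb S w 0 = (stdGaussian (EuclideanSpace ℝ (Fin n))).real
      {x | ∀ j ∈ S, x j ≤ inner ℝ w x * w j} := by
  simp [orthantProb, orthantPairs, replaceComponent_apply]

/-- Continuity holds because almost surely no coordinate in `S` of the residual vanishes. -/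
theorem continuousAt_orthantProb (hne : ∀ j ∈ S, w j ≠ 0) (hcard : 2 ≤ S.card) :
    ContinuousAt (orthantProb S w) 0 := by
  have hfun : orthantProb S w = fun s => ∫ x, (orthantPairs S w).indicator 1 (x, s)
      ∂(stdGaussian (EuclideanSpace ℝ (Fin n))) := funext orthantProb_eq_integral
  rw [hfun]
  refine continuousAt_of_dominated (bound := fun _ => 1)
    (Filter.Eventually.of_forall fun s => ?_) (Filter.Eventually.of_forall fun s =>
      ae_of_all _ fun x => ?_) (integrable_const _) ?_
  · exact ((measurable_one.indicator measurableSet_orthantPairs).comp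
      measurable_prodMk_right).aestronglyMeasurable
  · by_cases h : (x, s) ∈ orthantPairs S w <;> simp [h]
  · have hae : ∀ᵐ x ∂(stdGaussian (EuclideanSpace ℝ (Fin n))),
        ∀ j ∈ S, x j - inner ℝ w x * w j ≠ 0 := by
      rw [Finset.eventually_all]
      intro j hj
      have := stdGaussian_residual_coord hne hcard hj
      rw [ae_iff]
      simpa using this
    filter_upwards [hae] with x hx
    have hev : ∀ᶠ s in nhds (0 : ℝ), ∀ j ∈ S,
        (replaceComponent w x s j ≤ 0 ↔ replaceComponent w x 0 j ≤ 0) := by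
      rw [Finset.eventually_all]
      intro j hj
      have hcont : Continuous fun s : ℝ => x j - inner ℝ w x * w j + s * w j := by fun_prop
      have h0 := hcont.tendsto 0
      simp only [replaceComponent_apply]
      rcases lt_or_gt_of_ne (hx j hj) with h | h
      · filter_upwards [h0.eventually_lt_const (u := 0) (by simpa using h)] with s hs
        exact iff_of_true hs.le (by simpa using h.le)
      · filter_upwards [h0.eventually_const_lt (u := 0) (by simpa using h)] with s hs
        exact iff_of_false hs.not_ge (by simpa using h)
    refine (continuousAt_const (y := (orthantPairs S w).indicator
      (1 : EuclideanSpace ℝ (Fin n) × ℝ → ℝ) (x, 0))).congr ?_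
    filter_upwards [hev] with s hs
    have : (x, s) ∈ orthantPairs S w ↔ (x, (0 : ℝ)) ∈ orthantPairs S w :=
      forall₂_congr hs
    by_cases h : (x, (0 : ℝ)) ∈ orthantPairs S w
    · simp [h, this.2 h]
    · simp [h, this.not.2 h]

/-- The component along `w` of a standard Gaussian vector, restricted to the event that the
coordinates in `S` are nonpositive, has density `φ(s) * orthantProb S w s`. -/
theorem fourier_density_mul_orthantProb (hw : ‖w‖ = 1) (hoff : ∀ j ∉ S, w j = 0) (ξ : ℝ) :
    𝓕 (fun s : ℝ => ((gaussianPDFReal 0 1 s * orthantProb S w s : ℝ) : ℂ)) ξ =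
      cexp (-((2 * Real.pi * ξ : ℝ) : ℂ) ^ 2 / 2) *
        ∏ j ∈ S, cPhi (I * ((2 * Real.pi * ξ * w j : ℝ) : ℂ)) := by
  have hw' := sum_sq_eq_one_of_support hw hoff
  rw [← integral_indicator_orthant hw' hoff, ← map_replaceComponent_stdGaussian hw]
  set a := 2 * Real.pi * ξ with ha
  set H : EuclideanSpace ℝ (Fin n) → ℂ := {x | ∀ j ∈ S, x j ≤ 0}.indicator
    fun x => cexp (-((a * inner ℝ w x : ℝ) : ℂ) * I) with hH
  have hHm : Measurable H :=
    (by fun_prop : Measurable fun x : EuclideanSpace ℝ (Fin n) =>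
      cexp (-((a * inner ℝ w x : ℝ) : ℂ) * I)).indicator measurableSet_orthant
  have hmeas : Measurable fun p : EuclideanSpace ℝ (Fin n) × ℝ => replaceComponent w p.1 p.2 :=
    (continuous_replaceComponent w).measurable
  have hcomp (x : EuclideanSpace ℝ (Fin n)) (s : ℝ) : H (replaceComponent w x s) =
      cexp (-((a * s : ℝ) : ℂ) * I) * (((orthantPairs S w).indicator 1 (x, s) : ℝ) : ℂ) := by
    by_cases hp : (x, s) ∈ orthantPairs S w
    · rw [hH, indicator_of_mem (show replaceComponent w x s ∈ _ from hp),
        inner_replaceComponent hw]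
      simp [hp]
    · rw [hH, indicator_of_notMem (show replaceComponent w x s ∉ _ from hp)]
      simp [hp]
  rw [integral_map hmeas.aemeasurable hHm.aestronglyMeasurable, integral_prod_symm]
  · simp only [hcomp, integral_const_mul, integral_complex_ofReal]
    rw [integral_gaussianReal_eq_integral_smul one_ne_zero, Real.fourier_real_eq_integral_exp_smul]
    refine integral_congr_ae (ae_of_all _ fun s => ?_)
    simp only [← orthantProb_eq_integral, smul_eq_mul, Complex.real_smul]
    push_cast
    rw [show -2 * (Real.pi : ℂ) * s * ξ * I = -((a : ℂ) * s) * I by rw [ha]; push_cast; ring]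
    ring
  · refine Integrable.of_bound (hHm.comp hmeas).aestronglyMeasurable 1 (ae_of_all _ fun p => ?_)
    simp only [hcomp, norm_mul]
    rw [show -((a * p.2 : ℝ) : ℂ) * I = ((-(a * p.2) : ℝ) : ℂ) * I by push_cast; ring,
      Complex.norm_exp_ofReal_mul_I, one_mul]
    by_cases h : p ∈ orthantPairs S w <;> simp [h]

/-- Fourier inversion at `0` of the density of the component along `w`, restricted to an
orthant. -/
theorem integral_prod_cPhi_I_mul (hw : ‖w‖ = 1) (hoff : ∀ j ∉ S, w j = 0)
    (hne : ∀ j ∈ S, w j ≠ 0) (hcard : 2 ≤ S.card) :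
    ∫ g, ∏ j ∈ S, cPhi (I * ((g * w j : ℝ) : ℂ)) ∂(gaussianReal 0 1) =
      ((stdGaussian (EuclideanSpace ℝ (Fin n))).real
        {x | ∀ j ∈ S, x j ≤ inner ℝ w x * w j} : ℂ) := by
  have hw' := sum_sq_eq_one_of_support hw hoff
  set p : ℝ → ℂ := fun s => ((gaussianPDFReal 0 1 s * orthantProb S w s : ℝ) : ℂ) with hp
  set G : ℝ → ℂ := fun a => cexp (-(a : ℂ) ^ 2 / 2) * ∏ j ∈ S, cPhi (I * ((a * w j : ℝ) : ℂ))
    with hG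
  have hGint : Integrable G := integrable_exp_mul_prod_cPhi hne hw' hcard
  have hFp : 𝓕 p = fun ξ => G (2 * Real.pi * ξ) :=
    funext fun ξ => fourier_density_mul_orthantProb hw hoff ξ
  have hpi : 2 * Real.pi ≠ 0 := by positivity
  have hpint : Integrable p := by
    refine Integrable.ofReal ?_
    refine (integrable_gaussianPDFReal 0 1).mul_bdd (c := 1)
      measurable_orthantProb.aestronglyMeasurable (ae_of_all _ fun s => ?_)
    have := orthantProb_mem_Icc (S := S) (w := w) s
    rw [Real.norm_of_nonneg this.1]
    exact this.2
  have hcont : ContinuousAt p 0 := by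
    have h1 : ContinuousAt (gaussianPDFReal 0 1) 0 := by
      unfold gaussianPDFReal
      fun_prop
    exact Complex.continuous_ofReal.continuousAt.comp
      (h1.mul (continuousAt_orthantProb hne hcard))
  have hFpint : Integrable (𝓕 p) := by
    rw [hFp]
    exact hGint.comp_mul_left' hpi
  have hinv := hpint.fourierInv_fourier_eq hFpint hcont
  rw [Real.fourierInv_eq', hFp] at hinv
  simp only [inner_zero_right, mul_zero, Complex.ofReal_zero, zero_mul, Complex.exp_zero,
    one_smul] at hinv
  rw [Measure.integral_comp_mul_left, hp] at hinv
  rw [integral_gaussianReal_eq_cexp, ← orthantProb_zero]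
  have hsq : (Real.sqrt (2 * Real.pi) : ℂ) ^ 2 = 2 * Real.pi := by
    exact_mod_cast Real.sq_sqrt (by positivity : (0 : ℝ) ≤ 2 * Real.pi)
  have hs0 : (Real.sqrt (2 * Real.pi) : ℂ) ≠ 0 := by
    have : 0 < Real.sqrt (2 * Real.pi) := by positivity
    exact_mod_cast this.ne'
  simp only [Complex.ofReal_mul, gaussianPDFReal_std] at hinv
  rw [abs_of_pos (by positivity), Complex.real_smul] at hinv
  push_cast at hinv
  -- write `2π` as the square of `√(2π)`, so that one factor cancels against the density at `0`
  rw [← hsq] at hinv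
  simp only [ne_eq, OfNat.ofNat_ne_zero, not_false_eq_true, zero_pow, neg_zero, zero_div,
    Complex.exp_zero, mul_one] at hinv
  have h2 : ∫ y, G y = (Real.sqrt (2 * Real.pi) : ℂ) * (orthantProb S w 0 : ℂ) := by
    field_simp at hinv
    exact hinv
  change _ * ∫ y, G y = _
  rw [h2, ← mul_assoc, inv_mul_cancel₀ hs0, one_mul]

/-- A residual with all coordinates in `S` nonpositive is orthogonal to `w`; if `w` has constant
sign on `S`, this forces these coordinates to vanish. -/
theorem stdGaussian_residual_nonpos_of_sign (hw : ‖w‖ = 1) (hoff : ∀ j ∉ S, w j = 0)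
    (hsign : (∀ j ∈ S, 0 < w j) ∨ ∀ j ∈ S, w j < 0) (hcard : 2 ≤ S.card) :
    (stdGaussian (EuclideanSpace ℝ (Fin n))).real
      {x | ∀ j ∈ S, x j ≤ inner ℝ w x * w j} = 0 := by
  have hne : ∀ j ∈ S, w j ≠ 0 := fun j hj =>
    hsign.elim (fun h => (h j hj).ne') fun h => (h j hj).ne
  obtain ⟨i, hi⟩ : S.Nonempty := Finset.card_pos.1 (by omega)
  rw [measureReal_eq_zero_iff]
  refine measure_mono_null ?_ (stdGaussian_residual_coord hne hcard hi)
  intro x hx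
  have hw' : ∑ j ∈ S, w j * w j = 1 := by
    simpa only [sq] using sum_sq_eq_one_of_support hw hoff
  have hin := inner_eq_sum_of_support hoff x
  have hsum : ∑ j ∈ S, (x j - inner ℝ w x * w j) * w j = 0 := by
    simp only [sub_mul, Finset.sum_sub_distrib, mul_assoc, ← Finset.mul_sum, hw', ← hin]
    ring
  have hle : ∀ j ∈ S, x j - inner ℝ w x * w j ≤ 0 := fun j hj => sub_nonpos.2 (hx j hj)
  have hz : (x i - inner ℝ w x * w i) * w i = 0 := by
    rcases hsign with h | h
    · exact (Finset.sum_eq_zero_iff_of_nonpos fun j hj =>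
        mul_nonpos_of_nonpos_of_nonneg (hle j hj) (h j hj).le).1 hsum i hi
    · exact (Finset.sum_eq_zero_iff_of_nonneg fun j hj =>
        mul_nonneg_of_nonpos_of_nonpos (hle j hj) (h j hj).le).1 hsum i hi
  exact (mul_eq_zero.1 hz).resolve_right (hne i hi)

end Inversion

/-! ### The probability of a face -/

section FaceProbability

open Set

variable {n : ℕ} {S : Finset (Fin n)} {v w : EuclideanSpace ℝ (Fin n)}

/-- The coordinates in `S` and off `S` of a standard Gaussian vector are independent. -/
theorem stdGaussian_inter_halfSpaces (hoff : ∀ j ∉ S, w j = 0) (b : Fin n → ℝ) :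
    (stdGaussian (EuclideanSpace ℝ (Fin n)))
        {x | (∀ j ∈ S, x j ≤ inner ℝ w x * w j) ∧ ∀ j ∉ S, b j < x j} =
      (stdGaussian (EuclideanSpace ℝ (Fin n))) {x | ∀ j ∈ S, x j ≤ inner ℝ w x * w j} *
        ∏ j ∈ Sᶜ, gaussianReal 0 1 (Ioi (b j)) := by
  set γ := Measure.pi (fun _ : Fin n => gaussianReal 0 1) with hγ
  set A : Set (S → ℝ) := {y | ∀ j : S, y j ≤ (∑ i : S, y i * w i) * w j} with hA
  set B : Set ((Sᶜ : Finset (Fin n)) → ℝ) := {y | ∀ j : (Sᶜ : Finset (Fin n)), b j < y j} with hB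
  have hAm : MeasurableSet A := by
    have : A = ⋂ j : S, {y | y j ≤ (∑ i : S, y i * w i) * w j} := by ext; simp [hA]
    rw [this]
    exact MeasurableSet.iInter fun j => (isClosed_le (by fun_prop) (by fun_prop)).measurableSet
  have hBm : MeasurableSet B := by
    have : B = ⋂ j : (Sᶜ : Finset (Fin n)), {y | b j < y j} := by ext; simp [hB]
    rw [this]
    exact MeasurableSet.iInter fun j => (isOpen_lt (by fun_prop) (by fun_prop)).measurableSet
  have hind := ((iIndepFun_pi (μ := fun _ : Fin n => gaussianReal 0 1) (X := fun _ => id)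
    fun _ => aemeasurable_id).indepFun_finset S Sᶜ disjoint_compl_right
      fun i => measurable_pi_apply i).measure_inter_preimage_eq_mul A B hAm hBm
  have hpreA : (fun (x : Fin n → ℝ) (i : S) => id (x i)) ⁻¹' A =
      WithLp.toLp 2 ⁻¹' {x : EuclideanSpace ℝ (Fin n) | ∀ j ∈ S, x j ≤ inner ℝ w x * w j} := by
    ext x
    simp only [hA, mem_preimage, mem_ofPred_eq, id, inner_eq_sum_of_support hoff,
      Subtype.forall]
    rw [Finset.sum_coe_sort S fun i => x i * w i]
  have hpreB : (fun (x : Fin n → ℝ) (i : (Sᶜ : Finset (Fin n))) => id (x i)) ⁻¹' B =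
      WithLp.toLp 2 ⁻¹' {x : EuclideanSpace ℝ (Fin n) | ∀ j ∉ S, b j < x j} := by
    ext x
    simp [hB]
  have hboxB : γ (WithLp.toLp 2 ⁻¹' {x : EuclideanSpace ℝ (Fin n) | ∀ j ∉ S, b j < x j}) =
      ∏ j ∈ Sᶜ, gaussianReal 0 1 (Ioi (b j)) := by
    have : WithLp.toLp 2 ⁻¹' {x : EuclideanSpace ℝ (Fin n) | ∀ j ∉ S, b j < x j} =
        univ.pi fun j => if j ∈ Sᶜ then Ioi (b j) else univ := by
      ext x
      simp only [mem_preimage, mem_ofPred_eq, mem_univ_pi, Finset.mem_compl]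
      refine forall_congr' fun j => ?_
      split_ifs with h <;> simp [h]
    rw [this, hγ, Measure.pi_pi]
    have (j : Fin n) : gaussianReal 0 1 (if j ∈ Sᶜ then Ioi (b j) else univ) =
        if j ∈ Sᶜ then gaussianReal 0 1 (Ioi (b j)) else 1 := by
      split_ifs <;> simp
    simp only [this, Finset.prod_ite_mem, Finset.univ_inter]
  rw [hpreA, hpreB, ← hγ, hboxB] at hind
  have hm : Measurable (WithLp.toLp 2 : (Fin n → ℝ) → EuclideanSpace ℝ (Fin n)) := by fun_prop
  have hmA : MeasurableSet {x : EuclideanSpace ℝ (Fin n) | ∀ j ∈ S, x j ≤ inner ℝ w x * w j} := by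
    have : {x : EuclideanSpace ℝ (Fin n) | ∀ j ∈ S, x j ≤ inner ℝ w x * w j} =
        ⋂ j ∈ S, {x | x j ≤ inner ℝ w x * w j} := by ext; simp
    rw [this]
    exact Finset.measurableSet_biInter _ fun j _ =>
      (isClosed_le (by fun_prop) (by fun_prop)).measurableSet
  have hmB : MeasurableSet {x : EuclideanSpace ℝ (Fin n) | ∀ j ∉ S, b j < x j} := by
    have : {x : EuclideanSpace ℝ (Fin n) | ∀ j ∉ S, b j < x j} =
        ⋂ j ∈ Sᶜ, {x | b j < x j} := by ext; simp
    rw [this]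
    exact Finset.measurableSet_biInter _ fun j _ =>
      (isOpen_lt (by fun_prop) (by fun_prop)).measurableSet
  rw [← map_pi_eq_stdGaussian, ofPred_and, Measure.map_apply hm (hmA.inter hmB),
    Measure.map_apply hm hmA, preimage_inter, hind]

/-- Conditionally on the component along `w`, the residual in the coordinates `S` and the
coordinates off `S` are independent. -/
theorem stdGaussian_real_region (hw : ‖w‖ = 1) (hoff : ∀ j ∉ S, w j = 0) (d : Fin n → ℝ) :
    (stdGaussian (EuclideanSpace ℝ (Fin n))).real
        {x | (∀ j ∈ S, x j ≤ inner ℝ w x * w j) ∧ ∀ j ∉ S, inner ℝ w x * d j < x j} =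
      (stdGaussian (EuclideanSpace ℝ (Fin n))).real {x | ∀ j ∈ S, x j ≤ inner ℝ w x * w j} *
        ∫ s, ∏ j ∈ Sᶜ, (gaussianReal 0 1).real (Ioi (s * d j)) ∂(gaussianReal 0 1) := by
  have hmeas : Measurable fun p : EuclideanSpace ℝ (Fin n) × ℝ => replaceComponent w p.1 p.2 :=
    (continuous_replaceComponent w).measurable
  set R : Set (EuclideanSpace ℝ (Fin n)) :=
    {x | (∀ j ∈ S, x j ≤ inner ℝ w x * w j) ∧ ∀ j ∉ S, inner ℝ w x * d j < x j} with hR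
  have hRm : MeasurableSet R := by
    have : R = (⋂ j ∈ S, {x | x j ≤ inner ℝ w x * w j}) ∩
        ⋂ j ∈ Sᶜ, {x | inner ℝ w x * d j < x j} := by ext; simp [hR]
    rw [this]
    refine (Finset.measurableSet_biInter _ fun j _ => ?_).inter
      (Finset.measurableSet_biInter _ fun j _ => ?_)
    · exact (isClosed_le (by fun_prop) (by fun_prop)).measurableSet
    · exact (isOpen_lt (by fun_prop) (by fun_prop)).measurableSet
  have hslice (s : ℝ) : (fun x => (x, s)) ⁻¹'
      ((fun p : EuclideanSpace ℝ (Fin n) × ℝ => replaceComponent w p.1 p.2) ⁻¹' R) =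
      {x | (∀ j ∈ S, x j ≤ inner ℝ w x * w j) ∧ ∀ j ∉ S, s * d j < x j} := by
    ext x
    simp only [hR, mem_preimage, mem_ofPred_eq, inner_replaceComponent hw, replaceComponent_apply]
    refine and_congr (forall₂_congr fun j _ => ?_) (forall₂_congr fun j hj => ?_)
    · constructor <;> intro h <;> linarith
    · simp [hoff j hj]
  have hmain : stdGaussian (EuclideanSpace ℝ (Fin n)) R =
      stdGaussian (EuclideanSpace ℝ (Fin n)) {x | ∀ j ∈ S, x j ≤ inner ℝ w x * w j} *
        ∫⁻ s, ∏ j ∈ Sᶜ, gaussianReal 0 1 (Ioi (s * d j)) ∂(gaussianReal 0 1) := by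
    conv_lhs => rw [← map_replaceComponent_stdGaussian hw, Measure.map_apply hmeas hRm,
      Measure.prod_apply_symm (hmeas hRm)]
    simp only [hslice, stdGaussian_inter_halfSpaces hoff]
    rw [lintegral_const_mul' _ _ (measure_ne_top _ _)]
  have hmI (j : Fin n) : Measurable fun s : ℝ => gaussianReal 0 1 (Ioi (s * d j)) :=
    measurable_measure_prodMk_left (ν := gaussianReal 0 1)
      (isOpen_lt (by fun_prop : Continuous fun p : ℝ × ℝ => p.1 * d j)
        (by fun_prop : Continuous fun p : ℝ × ℝ => p.2)).measurableSet
  rw [measureReal_def, hmain, ENNReal.toReal_mul, measureReal_def]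
  congr 1
  rw [← integral_toReal (Finset.measurable_prod _ fun j _ => hmI j).aemeasurable
    (ae_of_all _ fun s => ENNReal.prod_lt_top fun j _ => measure_lt_top _ _)]
  simp only [ENNReal.toReal_prod, measureReal_def]

/-- The upper tails can be replaced by distribution functions: substitute `s ↦ -s`. -/
theorem integral_prod_Ioi_eq (T : Finset (Fin n)) (d : Fin n → ℝ) :
    ∫ s, ∏ j ∈ T, (gaussianReal 0 1).real (Ioi (s * d j)) ∂(gaussianReal 0 1) =
      ∫ s, ∏ j ∈ T, (gaussianReal 0 1).real (Iic (s * d j)) ∂(gaussianReal 0 1) := by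
  have hneg : (gaussianReal 0 1).map (fun x : ℝ => -x) = gaussianReal 0 1 := by
    rw [gaussianReal_map_neg, neg_zero]
  have := nullSingletonClass_gaussianReal (μ := 0) (v := 1) one_ne_zero
  have htail (x : ℝ) : (gaussianReal 0 1).real (Ioi (-x)) = (gaussianReal 0 1).real (Iic x) := by
    conv_lhs => rw [← hneg, map_measureReal_apply measurable_neg measurableSet_Ioi]
    have : (fun x : ℝ => -x) ⁻¹' Ioi (-x) = Iio x := by ext; simp
    rw [this]
    exact measureReal_congr Iio_ae_eq_Iic
  have h := integral_map_equiv (μ := gaussianReal 0 1) (MeasurableEquiv.neg ℝ)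
    fun s => ∏ j ∈ T, (gaussianReal 0 1).real (Ioi (s * d j))
  rw [show ⇑(MeasurableEquiv.neg ℝ) = fun x : ℝ => -x from rfl, hneg] at h
  rw [h]
  simp only [neg_mul, htail]

end FaceProbability

/-! ### The formula for a single index set -/

section Formula

open Set Complex

variable {n : ℕ} {S : Finset (Fin n)} {v : EuclideanSpace ℝ (Fin n)}

/-- The unit vector `v_S / ‖v‖_S`, extended by zero. -/
noncomputable def unitPart (v : EuclideanSpace ℝ (Fin n)) (S : Finset (Fin n)) :
    EuclideanSpace ℝ (Fin n) :=
  WithLp.toLp 2 fun j => if j ∈ S then v j / partNorm v S else 0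

theorem unitPart_of_mem {j : Fin n} (hj : j ∈ S) : unitPart v S j = v j / partNorm v S := by
  simp [unitPart, hj]

theorem unitPart_of_notMem {j : Fin n} (hj : j ∉ S) : unitPart v S j = 0 := by
  simp [unitPart, hj]

theorem partNorm_pos (hv : ∀ i, v i ≠ 0) (hS : S.Nonempty) : 0 < partNorm v S :=
  Real.sqrt_pos.2 (sum_sq_pos hv hS)

theorem sq_partNorm : partNorm v S ^ 2 = ∑ j ∈ S, v j ^ 2 :=
  Real.sq_sqrt (Finset.sum_nonneg fun _ _ => sq_nonneg _)

theorem sum_sq_unitPart (hv : ∀ i, v i ≠ 0) (hS : S.Nonempty) :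
    ∑ j ∈ S, unitPart v S j ^ 2 = 1 := by
  rw [Finset.sum_congr rfl fun j hj => by rw [unitPart_of_mem hj, div_pow], ← Finset.sum_div,
    ← sq_partNorm, div_self (pow_pos (partNorm_pos hv hS) 2).ne']

theorem norm_unitPart (hv : ∀ i, v i ≠ 0) (hS : S.Nonempty) : ‖unitPart v S‖ = 1 := by
  rw [← sq_eq_sq₀ (norm_nonneg _) zero_le_one, EuclideanSpace.real_norm_sq_eq, one_pow,
    ← sum_sq_unitPart hv hS]
  exact (Finset.sum_subset (Finset.subset_univ S) fun j _ hj => by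
    simp [unitPart_of_notMem hj]).symm

theorem unitPart_ne_zero (hv : ∀ i, v i ≠ 0) (hS : S.Nonempty) :
    ∀ j ∈ S, unitPart v S j ≠ 0 := fun j hj => by
  rw [unitPart_of_mem hj]
  exact div_ne_zero (hv j) (partNorm_pos hv hS).ne'

theorem lineCoeff_eq (x : EuclideanSpace ℝ (Fin n)) :
    lineCoeff v S x = inner ℝ (unitPart v S) x / partNorm v S := by
  have h : ∑ j ∈ S, x j * unitPart v S j = (∑ j ∈ S, x j * v j) / partNorm v S := by
    rw [Finset.sum_div]
    exact Finset.sum_congr rfl fun j hj => by rw [unitPart_of_mem hj, mul_div_assoc]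
  rw [inner_eq_sum_of_support (S := S) fun j hj => unitPart_of_notMem hj, h, lineCoeff,
    ← sq_partNorm, div_div, sq]

theorem projRegion_eq : projRegion v S =
    {x | (∀ j ∈ S, x j ≤ inner ℝ (unitPart v S) x * unitPart v S j) ∧
      ∀ j ∉ S, inner ℝ (unitPart v S) x * (v j / partNorm v S) < x j} := by
  ext x
  simp only [projRegion, lineCoeff_eq, mem_ofPred_eq]
  refine and_congr (forall₂_congr fun j hj => ?_) (forall₂_congr fun j hj => ?_)
  · rw [unitPart_of_mem hj, div_mul_eq_mul_div, mul_div_assoc]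
  · rw [div_mul_eq_mul_div, mul_div_assoc]

theorem innerProd_eq : innerProd v S =
    fun g : ℝ => ∏ j ∈ S, cPhi (I * ((g * unitPart v S j : ℝ) : ℂ)) := by
  ext g
  refine Finset.prod_congr rfl fun j hj => ?_
  rw [unitPart_of_mem hj]
  congr 1
  push_cast
  ring

theorem outerProd_eq : outerProd v S = fun g : ℝ =>
    ((∏ j ∈ Sᶜ, (gaussianReal 0 1).real (Iic (g * (v j / partNorm v S))) : ℝ) : ℂ) := by
  ext g
  rw [outerProd, Complex.ofReal_prod]
  refine Finset.prod_congr rfl fun j hj => ?_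
  rw [← cPhi_ofReal]
  congr 1
  push_cast
  ring

theorem integrable_innerProd (hv : ∀ i, v i ≠ 0) (hcard : 2 ≤ S.card) :
    Integrable (innerProd v S) (gaussianReal 0 1) := by
  have hS : S.Nonempty := Finset.card_pos.1 (by omega)
  rw [innerProd_eq]
  exact integrable_prod_cPhi_I_mul (unitPart_ne_zero hv hS) (sum_sq_unitPart hv hS) hcard

theorem integrable_outerProd : Integrable (outerProd v S) (gaussianReal 0 1) := by
  have hcont : Continuous (outerProd v S) := by
    unfold outerProd
    exact continuous_finsetProd _ fun j _ => continuous_cPhi.comp (by fun_prop)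
  refine Integrable.of_bound hcont.aestronglyMeasurable 1 (ae_of_all _ fun g => ?_)
  rw [outerProd_eq, Complex.norm_real, Real.norm_of_nonneg
    (Finset.prod_nonneg fun _ _ => measureReal_nonneg)]
  exact Finset.prod_le_one (fun _ _ => measureReal_nonneg) fun _ _ => measureReal_le_one

/-- The probability of projecting into the relative interior of a given face. -/
theorem stdGaussian_real_projRegion (hv : ∀ i, v i ≠ 0) (hcard : 2 ≤ S.card) :
    ((stdGaussian (EuclideanSpace ℝ (Fin n))).real (projRegion v S) : ℂ) =
      (∫ g, innerProd v S g ∂(gaussianReal 0 1)) * ∫ g, outerProd v S g ∂(gaussianReal 0 1) := by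
  have hS : S.Nonempty := Finset.card_pos.1 (by omega)
  have hw := norm_unitPart hv hS
  have hoff : ∀ j ∉ S, unitPart v S j = 0 := fun j hj => unitPart_of_notMem hj
  rw [projRegion_eq, stdGaussian_real_region hw hoff, Complex.ofReal_mul,
    ← integral_prod_cPhi_I_mul hw hoff (unitPart_ne_zero hv hS) hcard, integral_prod_Ioi_eq,
    innerProd_eq, outerProd_eq, integral_complex_ofReal]

/-- Index sets on which `v` has a constant sign contribute nothing to the formula. -/
theorem integral_innerProd_of_not_isMixed (hv : ∀ i, v i ≠ 0) (hcard : 2 ≤ S.card)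
    (hS : ¬ IsMixed v S) : ∫ g, innerProd v S g ∂(gaussianReal 0 1) = 0 := by
  have hSne : S.Nonempty := Finset.card_pos.1 (by omega)
  have hw := norm_unitPart hv hSne
  have hoff : ∀ j ∉ S, unitPart v S j = 0 := fun j hj => unitPart_of_notMem hj
  have hP := partNorm_pos hv hSne
  rw [innerProd_eq, integral_prod_cPhi_I_mul hw hoff (unitPart_ne_zero hv hSne) hcard,
    stdGaussian_residual_nonpos_of_sign hw hoff ?_ hcard, Complex.ofReal_zero]
  rw [IsMixed, not_and_or] at hS
  push Not at hS
  rcases hS with h | h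
  · refine Or.inr fun j hj => ?_
    rw [unitPart_of_mem hj]
    exact div_neg_of_neg_of_pos (lt_of_le_of_ne (h j hj) (hv j)) hP
  · refine Or.inl fun j hj => ?_
    rw [unitPart_of_mem hj]
    exact div_pos (lt_of_le_of_ne (h j hj) (hv j).symm) hP

theorem disjoint_of_mem_signPairs {m : ℕ} {p : Finset (Fin n) × Finset (Fin n)}
    (hp : p ∈ signPairs v m) : Disjoint p.1 p.2 := by
  simp only [signPairs, Finset.mem_filter, Finset.mem_univ, true_and] at hp
  exact Finset.disjoint_left.2 fun j h1 h2 => (hp.1 j h1).not_gt (hp.2.1 j h2)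

theorem card_union_of_mem_signPairs {m : ℕ} {p : Finset (Fin n) × Finset (Fin n)}
    (hp : p ∈ signPairs v m) : (p.1 ∪ p.2).card = m := by
  rw [Finset.card_union_of_disjoint (disjoint_of_mem_signPairs hp)]
  simp only [signPairs, Finset.mem_filter, Finset.mem_univ, true_and] at hp
  exact hp.2.2

/-- The pairs `(L, R)` correspond to the sets `L ∪ R` of the given cardinality. -/
theorem sum_signPairs {M : Type*} [AddCommMonoid M] (hv : ∀ i, v i ≠ 0) (m : ℕ)
    (f : Finset (Fin n) → M) :
    ∑ p ∈ signPairs v m, f (p.1 ∪ p.2) = ∑ S : Finset (Fin n) with S.card = m, f S := by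
  classical
  refine Finset.sum_bij' (fun p _ => p.1 ∪ p.2)
    (fun S _ => (S.filter fun j => 0 < v j, S.filter fun j => v j < 0)) ?_ ?_ ?_ ?_ ?_
  · intro p hp
    simp [card_union_of_mem_signPairs hp]
  · intro S hS
    simp only [Finset.mem_filter, Finset.mem_univ, true_and] at hS
    simp only [signPairs, Finset.mem_filter, Finset.mem_univ, true_and]
    refine ⟨fun j hj => hj.2, fun j hj => hj.2, ?_⟩
    rw [← hS, ← Finset.card_filter_add_card_filter_not (s := S) fun j => 0 < v j]
    congr 2
    refine Finset.filter_congr fun j _ => ?_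
    rw [not_lt]
    exact ⟨le_of_lt, fun h => lt_of_le_of_ne h (hv j)⟩
  · intro p hp
    simp only [signPairs, Finset.mem_filter, Finset.mem_univ, true_and] at hp
    ext j
    · simp only [Finset.mem_filter, Finset.mem_union]
      exact ⟨fun h => h.1.resolve_right fun h' => (hp.2.1 j h').not_gt h.2,
        fun h => ⟨Or.inl h, hp.1 j h⟩⟩
    · simp only [Finset.mem_filter, Finset.mem_union]
      exact ⟨fun h => h.1.resolve_left fun h' => (hp.1 j h').not_gt h.2,
        fun h => ⟨Or.inr h, hp.2.1 j h⟩⟩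
  · intro S _
    ext j
    simp only [Finset.mem_union, Finset.mem_filter]
    exact ⟨fun h => h.elim And.left And.left, fun h =>
      (lt_or_gt_of_ne (hv j)).elim (fun h' => Or.inr ⟨h, h'⟩) fun h' => Or.inl ⟨h, h'⟩⟩
  · intro p _
    rfl

end Formula

theorem mainTheorem3 (n : ℕ) (v : EuclideanSpace ℝ (Fin n)) (hv : ∀ i, v i ≠ 0)
    (hpos : ∃ i, 0 < v i) (hneg : ∃ i, v i < 0) :
    (∀ k : ℕ, 1 ≤ k → k ≤ n - 1 →
      (∀ p ∈ signPairs v (k + 1),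
        Integrable (innerProd v (p.1 ∪ p.2)) (gaussianReal 0 1) ∧
        Integrable (outerProd v (p.1 ∪ p.2)) (gaussianReal 0 1)) ∧
      (intrinsicVol (spanOrthant v) (n - k) : ℂ) =
        ∑ p ∈ signPairs v (k + 1),
          (∫ g, innerProd v (p.1 ∪ p.2) g ∂(gaussianReal 0 1)) *
          (∫ g, outerProd v (p.1 ∪ p.2) g ∂(gaussianReal 0 1))) ∧
    intrinsicVol (spanOrthant v) 0 = 0 ∧
    intrinsicVol (spanOrthant v) n =
      1 - ∑ k ∈ Finset.range n, intrinsicVol (spanOrthant v) k := by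
  classical
  refine ⟨fun k hk hkn => ⟨fun p hp => ⟨integrable_innerProd hv ?_, integrable_outerProd⟩, ?_⟩,
    intrinsicVol_zero hv hpos hneg, intrinsicVol_top hv hpos hneg⟩
  · rw [card_union_of_mem_signPairs hp]
    omega
  · rw [sum_signPairs hv (k + 1) fun S => (∫ g, innerProd v S g ∂(gaussianReal 0 1)) *
      ∫ g, outerProd v S g ∂(gaussianReal 0 1), intrinsicVol_sub_eq_sum hv hpos hneg hk hkn,
      Complex.ofReal_sum]
    have hsub : (Finset.univ.filter fun S : Finset (Fin n) => IsMixed v S ∧ S.card = k + 1) ⊆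
        Finset.univ.filter fun S : Finset (Fin n) => S.card = k + 1 :=
      Finset.monotone_filter_right _ fun S _ h => h.2
    rw [← Finset.sum_subset hsub]
    · refine Finset.sum_congr rfl fun S hS => stdGaussian_real_projRegion hv ?_
      simp only [Finset.mem_filter, Finset.mem_univ, true_and] at hS
      omega
    · intro S hS hS'
      simp only [Finset.mem_filter, Finset.mem_univ, true_and] at hS hS'
      rw [integral_innerProd_of_not_isMixed hv (by omega) fun h => hS' ⟨h, hS⟩, zero_mul]
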